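/- Rings are unital and associative. For a ring $A$, let $\mathrm{Bimod}(A)$ be the abelian category of $A$-bimodules with the monoidal structure $(\otimes_A, A)$. A coalgebra $D$ in $\mathrm{Bimod}(A)$ (an $A$-coring; coassociative and counital, $d\mapsto d_{(1)}\otimes d_{(2)}$) has a convolution ring $\mathrm{Hom}_A(D,A)_A$ of bimodule maps, with product $(\phi\psi)(d)=\phi(d_{(1)})\psi(d_{(2)})$ and unit the counit. A convolution representation of a ring $B$ over $A$ is such a $D$ with a ring homomorphism $B\to\mathrm{Hom}_A(D,A)_A$, $b\mapsto(d\mapsto b(d))$; it makes $D$ a $B$-bimodule by $b\cdot d=d_{(1)}b(d_{(2)})$, $d\cdot b=b(d_{(1)})d_{(2)}$. Two representations are isomorphic if there is an isomorphism of counital coalgebras $D\to D'$ compatible with the homomorphisms from $B$. The composite of $F\to\mathrm{Hom}_B(E,B)_B$ with $B\to\mathrm{Hom}_A(D,A)_A$ is the $A$-coring $E\otimes_{B^{o}\otimes B}D$, with counit $e\otimes d\mapsto \varepsilon(e)(d)$, comultiplication $e\otimes d\mapsto(e_{(1)}\otimes d_{(1)})\otimes(e_{(2)}\otimes d_{(2)})$,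 and homomorphism $x\mapsto\big(e\otimes d\mapsto x(e)(d)\big)$. The identity of $A$ is the coring $A\otimes A$, with counit $x\otimes y\mapsto xy$ and comultiplication $x\otimes y\mapsto(x\otimes1)\otimes(1\otimes y)$, and $a\mapsto(x\otimes y\mapsto xay)$. A noncommutative scheme $X$ is an abelian monoidal category $(\mathrm{Qcoh}(X),\otimes_X,\mathcal O_X)$ with biadditive $\otimes_X$. A morphism $X\to Y$ is an isomorphism class (under monoidal natural isomorphisms) of additive lax monoidal functors $f_*:\mathrm{Qcoh}(X)\to\mathrm{Qcoh}(Y)$, with unit morphism $\mathcal O_Y\to f_*\mathcal O_X$, that have a left adjoint $f^*$; composition is composition of the functors $f_*$. Put $\mathrm{Spec}(A)=(\mathrm{Bimod}(A),\otimes_A,A)$. Theorem. (1) Rings, with the isomorphism classes of convolution representations of $B$ over $A$ as morphisms $B\to A$ and with the above composition and identities, form a category. (2) Sending $A$ to $\mathrm{Spec}(A)$, and the class of $B\to\mathrm{Hom}_A(D,A)_A$ to the class of the functor $f_*=\mathrm{Hom}_A(D,-)_A:\mathrm{Bimod}(A)\to\mathrm{Bimod}(B)$ (with left adjoint $-\otimes_{B^{o}\otimes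 B}D$) with monoidal structure $n_1\otimes n_2\mapsto\big(d\mapsto n_1(d_{(1)})\otimes n_2(d_{(2)})\big)$ and unit $B\to f_*A$ given by the representation, is a contravariant functor to noncommutative schemes, and it is full and faithful. (3) In the reverse direction, let $f:\mathrm{Spec}(A)\to\mathrm{Spec}(B)$ be a morphism and let $f^*$ be an additive comonoidal left adjoint of $f_*$ whose comonoidal structure corresponds to the monoidal structure of $f_*$. Then $D=f^*(B\otimes B)$, with the coalgebra structure induced from that of $B\otimes B$ and with the composite $B=\mathrm{Hom}_B(B\otimes B,B)_B\to\mathrm{Hom}_A(f^*(B\otimes B),f^*B)_A\to\mathrm{Hom}_A(D,A)_A$, is a convolution representation of $B$ over $A$ whose image under the functor in (2) is $f$. -/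

import Mathlib

open CategoryTheory MonoidalCategory

universe v u

namespace NCS

/-! ### Balanced tensor products of abelian groups -/

section Bal

variable {ι : Type*} {M N P : Type*} [AddCommGroup M] [AddCommGroup N] [AddCommGroup P]

/-- The subgroup of `M ⊗ N` generated by all `(r i m) ⊗ n - m ⊗ (l i n)`. -/
def balRel (r : ι → M →+ M) (l : ι → N →+ N) : AddSubgroup (TensorProduct ℤ M N) :=
  AddSubgroup.closure
    {t | ∃ i m n, t = TensorProduct.tmul ℤ (r i m) n - TensorProduct.tmul ℤ m (l i n)}

/-- The quotient of `M ⊗ N` by the relations `(r i m) ⊗ n = m ⊗ (l i n)`. If `M` is a right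
module and `N` a left module over a ring, and `r i`, `l i` are the actions of its elements `i`
(or of a set of ring generators), this is the tensor product over that ring. -/
def Bal (r : ι → M →+ M) (l : ι → N →+ N) : Type _ := TensorProduct ℤ M N ⧸ balRel r l

namespace Bal

variable {r : ι → M →+ M} {l : ι → N →+ N}

instance : AddCommGroup (Bal r l) :=
  inferInstanceAs (AddCommGroup (TensorProduct ℤ M N ⧸ balRel r l))

/-- The class of a pure tensor. -/
def tmul (r : ι → M →+ M) (l : ι → N →+ N) (m : M) (n : N) : Bal r l :=
  QuotientAddGroup.mk' (balRel r l) (TensorProduct.tmul ℤ m n)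

lemma add_tmul (m m' : M) (n : N) : tmul r l (m + m') n = tmul r l m n + tmul r l m' n := by
  rw [tmul, TensorProduct.add_tmul]; rfl

lemma tmul_add (m : M) (n n' : N) : tmul r l m (n + n') = tmul r l m n + tmul r l m n' := by
  rw [tmul, TensorProduct.tmul_add]; rfl

lemma balance (i : ι) (m : M) (n : N) : tmul r l (r i m) n = tmul r l m (l i n) := by
  rw [← sub_eq_zero]
  exact (QuotientAddGroup.eq_zero_iff _).2 (AddSubgroup.subset_closure ⟨i, m, n, rfl⟩)

/-- The pure tensor map as a biadditive map. -/
def tmulHom (r : ι → M →+ M) (l : ι → N →+ N) : M →+ N →+ Bal r l :=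
  AddMonoidHom.mk' (fun m => AddMonoidHom.mk' (tmul r l m) (tmul_add m))
    (fun m m' => by ext n; exact add_tmul m m' n)

@[simp] lemma tmulHom_apply (m : M) (n : N) : tmulHom r l m n = tmul r l m n := rfl

lemma zero_tmul (n : N) : tmul r l 0 n = 0 := by
  rw [← tmulHom_apply, map_zero, AddMonoidHom.zero_apply]

lemma tmul_zero (m : M) : tmul r l m 0 = 0 := by
  rw [← tmulHom_apply, map_zero]

/-- The universal property. -/
def lift (f : M →+ N →+ P) (h : ∀ i m n, f (r i m) n = f m (l i n)) : Bal r l →+ P :=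
  QuotientAddGroup.lift _ (TensorProduct.liftAddHom f (fun z m n => by simp))
    (by
      rw [balRel, AddSubgroup.closure_le]
      rintro _ ⟨i, m, n, rfl⟩
      simp [AddMonoidHom.mem_ker, h])

@[simp] lemma lift_tmul (f : M →+ N →+ P) (h : ∀ i m n, f (r i m) n = f m (l i n)) (m : M)
    (n : N) : lift f h (tmul r l m n) = f m n := rfl

lemma induction {p : Bal r l → Prop} (zero : p 0) (tm : ∀ m n, p (tmul r l m n))
    (add : ∀ x y, p x → p y → p (x + y)) (x : Bal r l) : p x := by
  obtain ⟨x, rfl⟩ := QuotientAddGroup.mk'_surjective _ x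
  induction x with
  | zero => exact zero
  | tmul m n => exact tm m n
  | add x y hx hy => exact add _ _ hx hy

lemma hom_ext {f g : Bal r l →+ P} (h : ∀ m n, f (tmul r l m n) = g (tmul r l m n)) : f = g := by
  ext x
  induction x using induction with
  | zero => simp
  | tm m n => exact h m n
  | add x y hx hy => simp [hx, hy]

variable {M' N' : Type*} [AddCommGroup M'] [AddCommGroup N'] {r' : ι → M' →+ M'}
  {l' : ι → N' →+ N'}

/-- Functoriality. -/
def map (f : M →+ M') (g : N →+ N') (hf : ∀ i m, f (r i m) = r' i (f m))
    (hg : ∀ i n, g (l i n) = l' i (g n)) : Bal r l →+ Bal r' l' :=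
  lift (AddMonoidHom.mk' (fun m => ((tmulHom r' l') (f m)).comp g) (fun m m' => by ext; simp))
    (fun i m n => by simp [hf, hg, balance])

@[simp] lemma map_tmul (f : M →+ M') (g : N →+ N') (hf : ∀ i m, f (r i m) = r' i (f m))
    (hg : ∀ i n, g (l i n) = l' i (g n)) (m : M) (n : N) :
    map (r := r) (l := l) (r' := r') (l' := l') f g hf hg (tmul r l m n) = tmul r' l' (f m) (g n) :=
  rfl

/-- Endomorphisms of the left factor act on the quotient. -/
def leftEnd {R : Type*} [Ring R] [Module R M]
    (h : ∀ i (s : R) m, r i (s • m) = s • r i m) : R →+* AddMonoid.End (Bal r l) where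
  toFun s := map (DistribSMul.toAddMonoidHom M s) (AddMonoidHom.id N)
    (fun i m => (h i s m).symm) (fun _ _ => rfl)
  map_one' := hom_ext fun m n => congrArg (fun m => tmul r l m n) (one_smul R m)
  map_mul' s t := hom_ext fun m n => congrArg (fun m => tmul r l m n) (mul_smul s t m)
  map_zero' := hom_ext fun m n => (congrArg (fun m => tmul r l m n) (zero_smul R m)).trans
    (zero_tmul n)
  map_add' s t := hom_ext fun m n => (congrArg (fun m => tmul r l m n) (add_smul s t m)).trans
    (add_tmul _ _ _)

/-- Endomorphisms of the right factor act on the quotient. -/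
def rightEnd {R : Type*} [Ring R] [Module R N]
    (h : ∀ i (s : R) n, l i (s • n) = s • l i n) : R →+* AddMonoid.End (Bal r l) where
  toFun s := map (AddMonoidHom.id M) (DistribSMul.toAddMonoidHom N s)
    (fun _ _ => rfl) (fun i n => (h i s n).symm)
  map_one' := hom_ext fun m n => congrArg (tmul r l m) (one_smul R n)
  map_mul' s t := hom_ext fun m n => congrArg (tmul r l m) (mul_smul s t n)
  map_zero' := hom_ext fun m n => (congrArg (tmul r l m) (zero_smul R n)).trans
    (tmul_zero m)
  map_add' s t := hom_ext fun m n => (congrArg (tmul r l m) (add_smul s t n)).trans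
    (tmul_add _ _ _)

/-- Scalar multiplication through the left factor. -/
@[reducible] def moduleLeft {R : Type*} [Ring R] [Module R M]
    (h : ∀ i (s : R) m, r i (s • m) = s • r i m) : Module R (Bal r l) :=
  Module.compHom (Bal r l) (leftEnd (r := r) (l := l) h)

/-- Scalar multiplication through the right factor. -/
@[reducible] def moduleRight {R : Type*} [Ring R] [Module R N]
    (h : ∀ i (s : R) n, l i (s • n) = s • l i n) : Module R (Bal r l) :=
  Module.compHom (Bal r l) (rightEnd (r := r) (l := l) h)

end Bal

end Bal

/-! ### Bimodules -/

/-- An `A`-bimodule: commuting left and right `A`-module structures. The right action of `a` is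
the action of `MulOpposite.op a`. -/
structure Bimodule (A : Type u) [Ring A] : Type (u + 1) where
  carrier : Type u
  [addCommGroup : AddCommGroup carrier]
  [left : Module A carrier]
  [right : Module Aᵐᵒᵖ carrier]
  [comm : SMulCommClass A Aᵐᵒᵖ carrier]

namespace Bimodule

attribute [instance] addCommGroup left right comm

variable {A : Type u} [Ring A]

instance : CoeSort (Bimodule A) (Type u) := ⟨carrier⟩

/-- Homomorphisms of bimodules. -/
@[ext] structure Hom (M N : Bimodule A) : Type u where
  hom : M →+ N
  map_left : ∀ (a : A) (m : M), hom (a • m) = a • hom m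
  map_right : ∀ (a : Aᵐᵒᵖ) (m : M), hom (a • m) = a • hom m

attribute [simp] Hom.map_left Hom.map_right

instance : Category (Bimodule A) where
  Hom := Hom
  id M := ⟨AddMonoidHom.id M, fun _ _ => rfl, fun _ _ => rfl⟩
  comp f g := ⟨g.hom.comp f.hom, fun _ _ => by simp, fun _ _ => by simp⟩

lemma hom_ext {M N : Bimodule A} {f g : M ⟶ N} (h : ∀ m, f.hom m = g.hom m) : f = g :=
  Hom.ext (AddMonoidHom.ext h)

@[simp] lemma id_hom (M : Bimodule A) (m : M) : Hom.hom (𝟙 M) m = m := rfl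

@[simp] lemma comp_hom {M N P : Bimodule A} (f : M ⟶ N) (g : N ⟶ P) (m : M) :
    (f ≫ g).hom m = g.hom (f.hom m) := rfl

section Preadditive

variable {M N : Bimodule A}

instance : Zero (M ⟶ N) := ⟨⟨0, by simp, by simp⟩⟩
instance : Add (M ⟶ N) := ⟨fun f g => ⟨f.hom + g.hom, by simp, by simp⟩⟩
instance : Neg (M ⟶ N) := ⟨fun f => ⟨-f.hom, by simp, by simp⟩⟩
instance : Sub (M ⟶ N) := ⟨fun f g => ⟨f.hom - g.hom, by simp [smul_sub], by simp [smul_sub]⟩⟩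
instance : SMul ℕ (M ⟶ N) :=
  ⟨fun k f => ⟨k • f.hom,
    fun a m => (congrArg (k • ·) (f.map_left a m)).trans (smul_comm k a (f.hom m)),
    fun a m => (congrArg (k • ·) (f.map_right a m)).trans (smul_comm k a (f.hom m))⟩⟩
instance : SMul ℤ (M ⟶ N) :=
  ⟨fun k f => ⟨k • f.hom,
    fun a m => (congrArg (k • ·) (f.map_left a m)).trans (smul_comm k a (f.hom m)),
    fun a m => (congrArg (k • ·) (f.map_right a m)).trans (smul_comm k a (f.hom m))⟩⟩

lemma homHom_injective : Function.Injective (fun f : M ⟶ N => f.hom) := fun _ _ h => Hom.ext h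

instance : AddCommGroup (M ⟶ N) :=
  homHom_injective.addCommGroup _ rfl (fun _ _ => rfl) (fun _ => rfl) (fun _ _ => rfl)
    (fun _ _ => rfl) (fun _ _ => rfl)

@[simp] lemma zero_hom (m : M) : Hom.hom (0 : M ⟶ N) m = 0 := rfl
@[simp] lemma add_hom (f g : M ⟶ N) (m : M) : (f + g).hom m = f.hom m + g.hom m := rfl

end Preadditive

instance : Preadditive (Bimodule A) where
  add_comp _ _ _ f f' g := hom_ext fun m => by simp
  comp_add _ _ _ f g g' := hom_ext fun m => by simp

/-- An isomorphism of bimodules from mutually inverse homomorphisms. -/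
def mkIso {M N : Bimodule A} (f : M ⟶ N) (g : N ⟶ M) (h : ∀ m, g.hom (f.hom m) = m)
    (h' : ∀ n, f.hom (g.hom n) = n) : M ≅ N :=
  ⟨f, g, hom_ext h, hom_ext h'⟩

/-! #### The category of bimodules is abelian -/

/-- A bimodule as a left module over the enveloping ring. -/
@[reducible] def envModule (M : Bimodule A) : Module (TensorProduct ℤ A Aᵐᵒᵖ) M :=
  TensorProduct.Algebra.module

section Env

attribute [local instance] envModule

lemma env_smul (M : Bimodule A) (a : A) (b : Aᵐᵒᵖ) (m : M) :
    TensorProduct.tmul ℤ a b • m = a • b • m := rfl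

/-- The functor to left modules over the enveloping ring. -/
def toEnv : Bimodule A ⥤ ModuleCat.{u} (TensorProduct ℤ A Aᵐᵒᵖ) where
  obj M := ModuleCat.of _ M
  map f := ModuleCat.ofHom
    { toFun := f.hom
      map_add' := map_add f.hom
      map_smul' := fun t m => by
        induction t with
        | zero =>
          exact (congrArg f.hom (zero_smul (TensorProduct ℤ A Aᵐᵒᵖ) m)).trans
            ((map_zero f.hom).trans (zero_smul (TensorProduct ℤ A Aᵐᵒᵖ) (f.hom m)).symm)
        | tmul a b => simp [env_smul]
        | add x y hx hy => simp_all [add_smul] }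

instance : (toEnv (A := A)).Faithful where
  map_injective {M N} f g h := hom_ext fun m => by
    exact congrArg (fun k => k.hom m) h

instance : (toEnv (A := A)).Full where
  map_surjective {M N} f := by
    let f' : M →ₗ[TensorProduct ℤ A Aᵐᵒᵖ] N := f.hom
    refine ⟨⟨f'.toAddMonoidHom, fun a m => ?_, fun a m => ?_⟩, rfl⟩
    · simpa [env_smul] using f'.map_smul (TensorProduct.tmul ℤ a 1) m
    · simpa [env_smul] using f'.map_smul (TensorProduct.tmul ℤ 1 a) m

/-- A left module over the enveloping ring as a bimodule. -/
def ofEnv (X : ModuleCat.{u} (TensorProduct ℤ A Aᵐᵒᵖ)) : Bimodule A :=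
  letI : Module A X := Module.compHom X
    (Algebra.TensorProduct.includeLeftRingHom : A →+* TensorProduct ℤ A Aᵐᵒᵖ)
  letI : Module Aᵐᵒᵖ X := Module.compHom X
    ((Algebra.TensorProduct.includeRight : Aᵐᵒᵖ →ₐ[ℤ] TensorProduct ℤ A Aᵐᵒᵖ) :
      Aᵐᵒᵖ →+* TensorProduct ℤ A Aᵐᵒᵖ)
  haveI : SMulCommClass A Aᵐᵒᵖ X := ⟨fun a b x => by
    change TensorProduct.tmul ℤ a (1 : Aᵐᵒᵖ) • TensorProduct.tmul ℤ (1 : A) b • x =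
      TensorProduct.tmul ℤ (1 : A) b • TensorProduct.tmul ℤ a (1 : Aᵐᵒᵖ) • x
    simp only [← mul_smul, Algebra.TensorProduct.tmul_mul_tmul, one_mul, mul_one]⟩
  ⟨X⟩

instance : (toEnv (A := A)).EssSurj where
  mem_essImage X := by
    let e : ofEnv X ≃+ X := AddEquiv.refl X
    have hl : ∀ (a : A) (y : ofEnv X), e (a • y) = TensorProduct.tmul ℤ a (1 : Aᵐᵒᵖ) • e y :=
      fun _ _ => rfl
    have hr : ∀ (a : Aᵐᵒᵖ) (y : ofEnv X), e (a • y) = TensorProduct.tmul ℤ (1 : A) a • e y :=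
      fun _ _ => rfl
    have key : ∀ (t : TensorProduct ℤ A Aᵐᵒᵖ) (y : ofEnv X), e (t • y) = t • e y := by
      intro t y
      induction t with
      | zero =>
        exact (congrArg e (zero_smul (TensorProduct ℤ A Aᵐᵒᵖ) y)).trans
          ((map_zero e).trans (zero_smul (TensorProduct ℤ A Aᵐᵒᵖ) (e y)).symm)
      | tmul a b =>
        rw [env_smul, hl, hr, ← mul_smul, Algebra.TensorProduct.tmul_mul_tmul, one_mul, mul_one]
      | add s t hs ht =>
        rw [add_smul, map_add, hs, ht, add_smul]
    exact ⟨ofEnv X, ⟨LinearEquiv.toModuleIso (X₁ := ofEnv X) (X₂ := X)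
      { e with map_smul' := key }⟩⟩

end Env

instance : (toEnv (A := A)).IsEquivalence where

instance : Limits.HasFiniteProducts (Bimodule A) :=
  ⟨fun _ => Adjunction.hasLimitsOfShape_of_equivalence toEnv⟩

noncomputable instance : Abelian (Bimodule A) := abelianOfEquivalence toEnv

/-! #### The tensor product over `A` -/

/-- Left multiplication by `a`. -/
def lmul (M : Bimodule A) (a : A) : M →+ M := DistribSMul.toAddMonoidHom M a

/-- Right multiplication by `a`. -/
def rmul (M : Bimodule A) (a : A) : M →+ M :=
  DistribSMul.toAddMonoidHom M (MulOpposite.op a)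

@[simp] lemma lmul_apply (M : Bimodule A) (a : A) (m : M) : M.lmul a m = a • m := rfl
@[simp] lemma rmul_apply (M : Bimodule A) (a : A) (m : M) :
    M.rmul a m = MulOpposite.op a • m := rfl

/-- The tensor product `M ⊗_A N`, with the left action on `M` and the right action on `N`. -/
def tensor (M N : Bimodule A) : Bimodule A :=
  letI : Module A (Bal M.rmul N.lmul) :=
    Bal.moduleLeft fun a b m => (smul_comm b (MulOpposite.op a) m).symm
  letI : Module Aᵐᵒᵖ (Bal M.rmul N.lmul) :=
    Bal.moduleRight fun a b n => smul_comm a b n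
  haveI : SMulCommClass A Aᵐᵒᵖ (Bal M.rmul N.lmul) := ⟨fun a b x => by
    induction x using Bal.induction with
    | zero => simp
    | tm m n => rfl
    | add x y hx hy => simp only [smul_add, hx, hy]⟩
  ⟨Bal M.rmul N.lmul⟩

/-- Pure tensors in `M ⊗_A N`. -/
def tmul {M N : Bimodule A} (m : M) (n : N) : M.tensor N := Bal.tmul M.rmul N.lmul m n

section tmul

variable {M N P Q : Bimodule A}

lemma smul_tmul (a : A) (m : M) (n : N) : a • tmul m n = tmul (a • m) n := rfl
lemma op_smul_tmul (a : Aᵐᵒᵖ) (m : M) (n : N) : a • tmul m n = tmul m (a • n) := rfl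
lemma balance (a : A) (m : M) (n : N) : tmul (MulOpposite.op a • m) n = tmul m (a • n) :=
  Bal.balance a m n
lemma add_tmul (m m' : M) (n : N) : tmul (m + m') n = tmul m n + tmul m' n := Bal.add_tmul m m' n
lemma tmul_add (m : M) (n n' : N) : tmul m (n + n') = tmul m n + tmul m n' := Bal.tmul_add m n n'
lemma zero_tmul (n : N) : tmul (0 : M) n = 0 := Bal.zero_tmul n
lemma tmul_zero (m : M) : tmul m (0 : N) = 0 := Bal.tmul_zero m

@[elab_as_elim]
lemma tensor_induction {p : M.tensor N → Prop} (zero : p 0) (tm : ∀ m n, p (tmul m n))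
    (add : ∀ x y, p x → p y → p (x + y)) (x : M.tensor N) : p x :=
  Bal.induction zero tm add x

/-- A biadditive map as a function of two variables. -/
def biadd {X Y Z : Type*} [AddCommGroup X] [AddCommGroup Y] [AddCommGroup Z] (f : X → Y → Z)
    (h₁ : ∀ x x' y, f (x + x') y = f x y + f x' y) (h₂ : ∀ x y y', f x (y + y') = f x y + f x y') :
    X →+ Y →+ Z :=
  AddMonoidHom.mk' (fun x => AddMonoidHom.mk' (f x) (h₂ x)) (fun x x' => by ext y; exact h₁ x x' y)

@[simp] lemma biadd_apply {X Y Z : Type*} [AddCommGroup X] [AddCommGroup Y] [AddCommGroup Z]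
    (f : X → Y → Z) (h₁ h₂) (x : X) (y : Y) : biadd f h₁ h₂ x y = f x y := rfl

/-- The universal property of `M ⊗_A N`, for additive maps. -/
def tliftAdd (f : M →+ N →+ P) (hb : ∀ (a : A) m n, f (MulOpposite.op a • m) n = f m (a • n)) :
    M.tensor N →+ P :=
  Bal.lift f hb

@[simp] lemma tliftAdd_tmul (f : M →+ N →+ P) (hb) (m : M) (n : N) :
    tliftAdd f hb (tmul m n) = f m n := rfl

/-- The universal property of `M ⊗_A N`. -/
def tlift (f : M →+ N →+ P) (hb : ∀ (a : A) m n, f (MulOpposite.op a • m) n = f m (a • n))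
    (hl : ∀ (a : A) m n, f (a • m) n = a • f m n)
    (hr : ∀ (a : Aᵐᵒᵖ) m n, f m (a • n) = a • f m n) : M.tensor N ⟶ P where
  hom := tliftAdd f hb
  map_left a x := by
    induction x using tensor_induction with
    | zero => simp only [smul_zero, map_zero]
    | tm m n => exact hl a m n
    | add x y hx hy => rw [smul_add, map_add, hx, hy, map_add, smul_add]
  map_right a x := by
    induction x using tensor_induction with
    | zero => simp only [smul_zero, map_zero]
    | tm m n => exact hr a m n
    | add x y hx hy => rw [smul_add, map_add, hx, hy, map_add, smul_add]

@[simp] lemma tlift_tmul (f : M →+ N →+ P) (hb hl hr) (m : M) (n : N) :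
    (tlift f hb hl hr).hom (tmul m n) = f m n := rfl

lemma tensor_ext {f g : M.tensor N ⟶ P} (h : ∀ m n, f.hom (tmul m n) = g.hom (tmul m n)) :
    f = g :=
  Hom.ext (Bal.hom_ext h)

lemma tensor_ext_right {f g : M.tensor (N.tensor P) ⟶ Q}
    (h : ∀ m n p, f.hom (tmul m (tmul n p)) = g.hom (tmul m (tmul n p))) : f = g := by
  refine tensor_ext fun m x => ?_
  induction x using tensor_induction with
  | zero => rw [tmul_zero, map_zero, map_zero]
  | tm n p => exact h m n p
  | add x y hx hy => rw [tmul_add, map_add, map_add, hx, hy]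

lemma tensor_ext_left {f g : (M.tensor N).tensor P ⟶ Q}
    (h : ∀ m n p, f.hom (tmul (tmul m n) p) = g.hom (tmul (tmul m n) p)) : f = g := by
  refine tensor_ext fun x p => ?_
  induction x using tensor_induction with
  | zero => rw [zero_tmul, map_zero, map_zero]
  | tm m n => exact h m n p
  | add x y hx hy => rw [add_tmul, map_add, map_add, hx, hy]

lemma tensor_ext_left₂ {R : Bimodule A} {f g : ((M.tensor N).tensor P).tensor Q ⟶ R}
    (h : ∀ m n p q, f.hom (tmul (tmul (tmul m n) p) q) = g.hom (tmul (tmul (tmul m n) p) q)) :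
    f = g := by
  refine tensor_ext_left fun x p q => ?_
  induction x using tensor_induction with
  | zero => rw [zero_tmul, zero_tmul, map_zero, map_zero]
  | tm m n => exact h m n p q
  | add x y hx hy => rw [add_tmul, add_tmul, map_add, map_add, hx, hy]

end tmul

/-- The regular bimodule. -/
def regular (A : Type u) [Ring A] : Bimodule A := ⟨A⟩

/-- `f ⊗ g`. -/
def tmap {M N M' N' : Bimodule A} (f : M ⟶ M') (g : N ⟶ N') : M.tensor N ⟶ M'.tensor N' :=
  tlift (biadd (fun m n => tmul (f.hom m) (g.hom n)) (by simp [add_tmul]) (by simp [tmul_add]))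
    (by simp [balance]) (by simp [smul_tmul]) (by simp [op_smul_tmul])

@[simp] lemma tmap_tmul {M N M' N' : Bimodule A} (f : M ⟶ M') (g : N ⟶ N') (m : M) (n : N) :
    (tmap f g).hom (tmul m n) = tmul (f.hom m) (g.hom n) := rfl

/-- The map `M ⊗ N → P` for fixed third factor, as an auxiliary morphism of abelian groups. -/
def assocAux (M N P : Bimodule A) (p : P) : M.tensor N →+ M.tensor (N.tensor P) :=
  Bal.lift (biadd (fun m n => tmul m (tmul n p)) (by simp [add_tmul])
    (by simp [add_tmul, tmul_add])) (fun a m n => by simp [balance, smul_tmul])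

/-- The map `N ⊗ P → M ⊗ N` for fixed first factor, as an auxiliary morphism of abelian groups. -/
def assocInvAux (M N P : Bimodule A) (m : M) : N.tensor P →+ (M.tensor N).tensor P :=
  Bal.lift (biadd (fun n p => tmul (tmul m n) p) (by simp [add_tmul, tmul_add])
    (by simp [tmul_add])) (fun a n p => by simp [← balance, op_smul_tmul])

/-- `(M ⊗ N) ⊗ P → M ⊗ (N ⊗ P)`. -/
def assocHom (M N P : Bimodule A) : (M.tensor N).tensor P ⟶ M.tensor (N.tensor P) :=
  tlift (biadd (fun x p => assocAux M N P p x) (by simp) (fun x p p' => by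
      rw [← AddMonoidHom.add_apply]
      refine DFunLike.congr_fun (Bal.hom_ext fun m n => ?_) x
      change tmul m (tmul n (p + p')) = tmul m (tmul n p) + tmul m (tmul n p')
      rw [tmul_add, tmul_add]))
    (fun a x p => by
      induction x using tensor_induction with
      | zero => simp
      | tm m n =>
        change tmul m (tmul (MulOpposite.op a • n) p) = tmul m (tmul n (a • p))
        rw [balance]
      | add x y hx hy => simp_all)
    (fun a x p => by
      induction x using tensor_induction with
      | zero => simp
      | tm m n => rfl
      | add x y hx hy => simp_all)
    (fun a x p => by
      induction x using tensor_induction with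
      | zero => simp
      | tm m n => rfl
      | add x y hx hy => simp_all)

/-- `M ⊗ (N ⊗ P) → (M ⊗ N) ⊗ P`. -/
def assocInv (M N P : Bimodule A) : M.tensor (N.tensor P) ⟶ (M.tensor N).tensor P :=
  tlift (biadd (fun m x => assocInvAux M N P m x) (fun m m' x => by
      rw [← AddMonoidHom.add_apply]
      refine DFunLike.congr_fun (Bal.hom_ext fun n p => ?_) x
      change tmul (tmul (m + m') n) p = tmul (tmul m n) p + tmul (tmul m' n) p
      rw [add_tmul, add_tmul]) (by simp))
    (fun a m x => by
      induction x using tensor_induction with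
      | zero => simp
      | tm n p =>
        change tmul (tmul (MulOpposite.op a • m) n) p = tmul (tmul m (a • n)) p
        rw [balance]
      | add x y hx hy => simp_all)
    (fun a m x => by
      induction x using tensor_induction with
      | zero => simp
      | tm n p => rfl
      | add x y hx hy => simp_all)
    (fun a m x => by
      induction x using tensor_induction with
      | zero => simp
      | tm n p => rfl
      | add x y hx hy => simp_all)

@[simp] lemma assocHom_tmul {M N P : Bimodule A} (m : M) (n : N) (p : P) :
    (assocHom M N P).hom (tmul (tmul m n) p) = tmul m (tmul n p) := rfl

@[simp] lemma assocInv_tmul {M N P : Bimodule A} (m : M) (n : N) (p : P) :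
    (assocInv M N P).hom (tmul m (tmul n p)) = tmul (tmul m n) p := rfl

/-- `A ⊗ M ≅ M`, `a ⊗ m ↦ a m`. -/
def lunit (M : Bimodule A) : (regular A).tensor M ≅ M where
  hom := tlift (M := regular A)
    (biadd (X := A) (fun a m => a • m) (fun a b m => add_smul a b m) (fun a m n => smul_add a m n))
    (fun a (b : A) m => mul_smul b a m) (fun a (b : A) m => mul_smul a b m)
    (fun a (b : A) m => smul_comm b a m)
  inv := ⟨AddMonoidHom.mk' (fun m => tmul (M := regular A) (1 : A) m) (fun _ _ => tmul_add _ _ _),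
    fun a m => (balance (M := regular A) a (1 : A) m).symm.trans
      (congrArg (fun b : A => tmul (M := regular A) b m) ((one_mul a).trans (mul_one a).symm)),
    fun _ _ => rfl⟩
  hom_inv_id := tensor_ext fun (a : A) m =>
    (balance (M := regular A) a (1 : A) m).symm.trans
      (congrArg (fun b : A => tmul (M := regular A) b m) (one_mul a))
  inv_hom_id := hom_ext fun m => one_smul A m

/-- `M ⊗ A ≅ M`, `m ⊗ a ↦ m a`. -/
def runit (M : Bimodule A) : M.tensor (regular A) ≅ M where
  hom := tlift (N := regular A)
    (biadd (Y := A) (fun m a => MulOpposite.op a • m) (fun m n a => smul_add _ m n)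
      (fun m a b => by rw [MulOpposite.op_add, add_smul]))
    (fun a m (b : A) => (mul_smul (MulOpposite.op b) (MulOpposite.op a) m).symm)
    (fun a m (b : A) => (smul_comm a (MulOpposite.op b) m).symm)
    (fun a m (b : A) => mul_smul a (MulOpposite.op b) m)
  inv := ⟨AddMonoidHom.mk' (fun m => tmul (N := regular A) m (1 : A)) (fun _ _ => add_tmul _ _ _),
    fun _ _ => rfl,
    fun a m => (balance (N := regular A) a.unop m (1 : A)).trans
      (congrArg (fun b : A => tmul (N := regular A) m b)
        ((mul_one a.unop).trans (one_mul a.unop).symm))⟩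
  hom_inv_id := tensor_ext fun m (a : A) =>
    (balance (N := regular A) a m (1 : A)).trans
      (congrArg (fun b : A => tmul (N := regular A) m b) (mul_one a))
  inv_hom_id := hom_ext fun m => one_smul Aᵐᵒᵖ m

instance : MonoidalCategoryStruct (Bimodule A) where
  tensorObj := tensor
  tensorUnit := regular A
  tensorHom := tmap
  whiskerLeft M _ _ f := tmap (𝟙 M) f
  whiskerRight f N := tmap f (𝟙 N)
  associator M N P := ⟨assocHom M N P, assocInv M N P, tensor_ext_left fun _ _ _ => rfl,
    tensor_ext_right fun _ _ _ => rfl⟩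
  leftUnitor := lunit
  rightUnitor := runit

instance : MonoidalCategory (Bimodule A) :=
  MonoidalCategory.ofTensorHom
    (id_tensorHom_id := fun _ _ => tensor_ext fun _ _ => rfl)
    (id_tensorHom := fun _ _ _ _ => rfl)
    (tensorHom_id := fun _ _ => rfl)
    (tensorHom_comp_tensorHom := fun _ _ _ _ => tensor_ext fun _ _ => rfl)
    (associator_naturality := fun _ _ _ => tensor_ext_left fun _ _ _ => rfl)
    (leftUnitor_naturality := fun f => tensor_ext fun (a : A) m => (f.map_left a m).symm)
    (rightUnitor_naturality := fun f => tensor_ext fun m (a : A) =>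
      (f.map_right (MulOpposite.op a) m).symm)
    (pentagon := fun _ _ _ _ => tensor_ext_left₂ fun _ _ _ _ => rfl)
    (triangle := fun _ _ => tensor_ext_left fun m (a : A) n => (balance a m n).symm)

instance : MonoidalPreadditive (Bimodule A) where
  whiskerLeft_zero := tensor_ext fun m _ => tmul_zero m
  zero_whiskerRight := tensor_ext fun _ n => zero_tmul n
  whiskerLeft_add _ _ := tensor_ext fun _ _ => tmul_add _ _ _
  add_whiskerRight _ _ := tensor_ext fun _ _ => add_tmul _ _ _

end Bimodule

/-! ### Noncommutative schemes -/

/-- A noncommutative scheme `X`: an abelian category `Qcoh(X)` with a biadditive monoidal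
structure. -/
structure NCScheme : Type (max (v + 1) (u + 1)) where
  Qcoh : Type u
  [category : Category.{v} Qcoh]
  [abelian : Abelian Qcoh]
  [monoidal : MonoidalCategory Qcoh]
  [biadditive : MonoidalPreadditive Qcoh]

namespace NCScheme

attribute [instance] category abelian monoidal biadditive

/-- A direct image functor: an additive (lax) monoidal functor `f_* : Qcoh(X) ⥤ Qcoh(Y)` that has
a left adjoint. Its unit morphism `𝒪_Y ⟶ f_* 𝒪_X` is part of the lax monoidal structure. -/
structure DirectImage (X Y : NCScheme.{v, u}) where
  functor : X.Qcoh ⥤ Y.Qcoh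
  [additive : functor.Additive]
  [lax : functor.LaxMonoidal]
  [isRightAdjoint : functor.IsRightAdjoint]

attribute [instance] DirectImage.additive DirectImage.lax DirectImage.isRightAdjoint

/-- Two direct image functors are identified if they are isomorphic through a natural
isomorphism compatible with the monoidal structures and with the unit morphisms. -/
def DirectImage.setoid (X Y : NCScheme.{v, u}) : Setoid (DirectImage X Y) where
  r f g := ∃ e : f.functor ≅ g.functor, NatTrans.IsMonoidal e.hom
  iseqv :=
    { refl := fun f => ⟨Iso.refl _, inferInstanceAs (NatTrans.IsMonoidal (𝟙 f.functor))⟩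
      symm := fun ⟨e, _⟩ => ⟨e.symm, inferInstanceAs (NatTrans.IsMonoidal e.inv)⟩
      trans := fun ⟨e, _⟩ ⟨e', _⟩ =>
        ⟨e ≪≫ e', inferInstanceAs (NatTrans.IsMonoidal (e.hom ≫ e'.hom))⟩ }

/-- Morphisms of noncommutative schemes: isomorphism classes of direct image functors. -/
def Hom (X Y : NCScheme.{v, u}) := Quotient (DirectImage.setoid X Y)

/-- The identity direct image. -/
def DirectImage.id (X : NCScheme.{v, u}) : DirectImage X X := ⟨𝟭 X.Qcoh⟩

/-- The direct image of a composite is the composite of the direct images. -/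
def DirectImage.comp {X Y Z : NCScheme.{v, u}} (f : DirectImage X Y) (g : DirectImage Y Z) :
    DirectImage X Z := ⟨f.functor ⋙ g.functor⟩

instance : Category NCScheme.{v, u} where
  Hom := Hom
  id X := Quotient.mk _ (DirectImage.id X)
  comp := Quotient.map₂ DirectImage.comp (by
    rintro f f' ⟨e, he⟩ g g' ⟨d, hd⟩
    exact ⟨Functor.isoWhiskerRight e g.functor ≪≫ Functor.isoWhiskerLeft f'.functor d,
      inferInstanceAs (NatTrans.IsMonoidal (Functor.whiskerRight e.hom g.functor ≫
        Functor.whiskerLeft f'.functor d.hom))⟩)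
  id_comp := by
    rintro X Y ⟨f⟩
    exact Quotient.sound ⟨f.functor.leftUnitor,
      inferInstanceAs (NatTrans.IsMonoidal f.functor.leftUnitor.hom)⟩
  comp_id := by
    rintro X Y ⟨f⟩
    exact Quotient.sound ⟨f.functor.rightUnitor,
      inferInstanceAs (NatTrans.IsMonoidal f.functor.rightUnitor.hom)⟩
  assoc := by
    rintro W X Y Z ⟨f⟩ ⟨g⟩ ⟨h⟩
    exact Quotient.sound ⟨Functor.associator f.functor g.functor h.functor,
      inferInstanceAs (NatTrans.IsMonoidal
        (Functor.associator f.functor g.functor h.functor).hom)⟩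

/-- The morphism `X ⟶ Y` given by a direct image functor. -/
def DirectImage.toHom {X Y : NCScheme.{v, u}} (f : DirectImage X Y) : X ⟶ Y := Quotient.mk _ f

/-- An inverse image functor of `f`: an additive comonoidal functor `f^* : Qcoh(Y) ⥤ Qcoh(X)` left
adjoint to `f_*`, such that the comonoidal structure of `f^*` and the monoidal structure of `f_*`
correspond to each other under the adjunction. The morphism `f^* 𝒪_Y ⟶ 𝒪_X` is part of the
comonoidal structure. -/
structure InverseImage {X Y : NCScheme.{v, u}} (f : DirectImage X Y) where
  functor : Y.Qcoh ⥤ X.Qcoh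
  [additive : functor.Additive]
  [oplax : functor.OplaxMonoidal]
  adj : functor ⊣ f.functor
  [isMonoidal : adj.IsMonoidal]

attribute [instance] InverseImage.additive InverseImage.oplax InverseImage.isMonoidal

end NCScheme

/-! ### Coalgebras and convolution -/

section Convolution

variable {C : Type u} [Category.{v} C] [MonoidalCategory C]

open ComonObj

/-- The convolution product `d ↦ f(d₍₁₎) g(d₍₂₎)` of two functionals on a coalgebra. -/
def conv {D : C} [ComonObj D] (f g : D ⟶ 𝟙_ C) : D ⟶ 𝟙_ C := Δ[D] ≫ (f ⊗ₘ g) ≫ (λ_ (𝟙_ C)).hom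

lemma conv_eq_mul {D : C} [ComonObj D] (f g : Conv D (𝟙_ C)) :
    conv (D := D) f g = (f * g : Conv D (𝟙_ C)) := by
  have h : ∀ f g : D ⟶ 𝟙_ C, conv f g = Δ[D] ≫ f ▷ D ≫ 𝟙_ C ◁ g ≫ (λ_ (𝟙_ C)).hom :=
    fun f g => by rw [conv, MonoidalCategory.tensorHom_def, Category.assoc]
  exact h f g

lemma counit_eq_one {D : C} [ComonObj D] : (ε[D] : D ⟶ 𝟙_ C) = (1 : Conv D (𝟙_ C)) :=
  (Category.comp_id ε[D]).symm

instance [Preadditive C] (D : C) : AddCommGroup (Conv D (𝟙_ C)) :=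
  inferInstanceAs (AddCommGroup (D ⟶ 𝟙_ C))

/-- The ring of functionals on a coalgebra, with the convolution product. -/
instance [Preadditive C] [MonoidalPreadditive C] (D : C) [ComonObj D] : Ring (Conv D (𝟙_ C)) :=
  { (inferInstance : Monoid (Conv D (𝟙_ C))), (inferInstance : AddCommGroup (Conv D (𝟙_ C))) with
    left_distrib := fun f g h => by
      have : ∀ f g h : D ⟶ 𝟙_ C, conv f (g + h) = conv f g + conv f h := fun f g h => by
        simp only [conv, MonoidalPreadditive.tensor_add, Preadditive.add_comp,
          Preadditive.comp_add]
      exact (conv_eq_mul f (g + h)).symm.trans ((this f g h).trans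
        (congrArg₂ (fun a b : Conv D (𝟙_ C) => a + b) (conv_eq_mul f g) (conv_eq_mul f h)))
    right_distrib := fun f g h => by
      have : ∀ f g h : D ⟶ 𝟙_ C, conv (f + g) h = conv f h + conv g h := fun f g h => by
        simp only [conv, MonoidalPreadditive.add_tensor, Preadditive.add_comp,
          Preadditive.comp_add]
      exact (conv_eq_mul (f + g) h).symm.trans ((this f g h).trans
        (congrArg₂ (fun a b : Conv D (𝟙_ C) => a + b) (conv_eq_mul f h) (conv_eq_mul g h)))
    zero_mul := fun f => by
      have : ∀ f : D ⟶ 𝟙_ C, conv (0 : D ⟶ 𝟙_ C) f = 0 := fun f => by simp [conv]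
      exact (conv_eq_mul 0 f).symm.trans (this f)
    mul_zero := fun f => by
      have : ∀ f : D ⟶ 𝟙_ C, conv f (0 : D ⟶ 𝟙_ C) = 0 := fun f => by simp [conv]
      exact (conv_eq_mul f 0).symm.trans (this f) }

/-- The action `d ↦ d₍₁₎ f(d₍₂₎)` of a functional on a coalgebra. -/
def actL {D : C} [ComonObj D] (f : D ⟶ 𝟙_ C) : D ⟶ D := Δ[D] ≫ D ◁ f ≫ (ρ_ D).hom

/-- The action `d ↦ f(d₍₁₎) d₍₂₎` of a functional on a coalgebra. -/
def actR {D : C} [ComonObj D] (f : D ⟶ 𝟙_ C) : D ⟶ D := Δ[D] ≫ f ▷ D ≫ (λ_ D).hom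

variable {D : C} [ComonObj D] (f g : D ⟶ 𝟙_ C)

lemma actR_comul : actR f ≫ Δ[D] = Δ[D] ≫ actR f ▷ D := by
  have h1 : actR f ≫ Δ[D] = Δ[D] ≫ D ◁ Δ[D] ≫ f ▷ (D ⊗ D) ≫ (λ_ (D ⊗ D)).hom := by
    simp only [actR, Category.assoc]
    rw [← leftUnitor_naturality, ← whisker_exchange_assoc]
  have h2 : Δ[D] ≫ actR f ▷ D = Δ[D] ≫ D ◁ Δ[D] ≫ f ▷ (D ⊗ D) ≫ (λ_ (D ⊗ D)).hom := by
    simp only [actR, comp_whiskerRight]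
    rw [ComonObj.comul_assoc_assoc]
    simp
  rw [h1, h2]

lemma actL_comul : actL f ≫ Δ[D] = Δ[D] ≫ D ◁ actL f := by
  have h1 : actL f ≫ Δ[D] = Δ[D] ≫ Δ[D] ▷ D ≫ (D ⊗ D) ◁ f ≫ (ρ_ (D ⊗ D)).hom := by
    simp only [actL, Category.assoc]
    rw [← rightUnitor_naturality, whisker_exchange_assoc]
  have h2 : Δ[D] ≫ D ◁ actL f = Δ[D] ≫ Δ[D] ▷ D ≫ (D ⊗ D) ◁ f ≫ (ρ_ (D ⊗ D)).hom := by
    simp only [actL, MonoidalCategory.whiskerLeft_comp]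
    rw [ComonObj.comul_assoc_assoc]
    simp
  rw [h1, h2]

lemma comul_balance : Δ[D] ≫ actL f ▷ D = Δ[D] ≫ D ◁ actR f := by
  simp only [actL, actR, MonoidalCategory.whiskerLeft_comp, comp_whiskerRight]
  rw [ComonObj.comul_assoc_assoc]
  simp

lemma actR_comp : actR f ≫ g = conv f g := by
  simp only [actR, conv, Category.assoc, MonoidalCategory.tensorHom_def]
  rw [← leftUnitor_naturality]

lemma actL_comp : actL g ≫ f = conv f g := by
  simp only [actL, conv, Category.assoc, MonoidalCategory.tensorHom_def]
  rw [← rightUnitor_naturality, whisker_exchange_assoc, ← unitors_equal]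

lemma actR_conv : actR (conv f g) = actR f ≫ actR g := by
  have h : actR f ≫ actR g = Δ[D] ≫ (actR f ≫ g) ▷ D ≫ (λ_ D).hom := by
    rw [comp_whiskerRight, Category.assoc, ← reassoc_of% (actR_comul f)]; rfl
  rw [h, actR_comp]; rfl

lemma actL_conv : actL (conv f g) = actL g ≫ actL f := by
  have h : actL g ≫ actL f = Δ[D] ≫ D ◁ (actL g ≫ f) ≫ (ρ_ D).hom := by
    rw [MonoidalCategory.whiskerLeft_comp, Category.assoc, ← reassoc_of% (actL_comul g)]; rfl
  rw [h, actL_comp]; rfl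

lemma actL_actR : actL f ≫ actR g = actR g ≫ actL f := by
  have h : actL f ≫ actR g = Δ[D] ≫ D ◁ actL f ≫ g ▷ D ≫ (λ_ D).hom := by
    rw [← reassoc_of% (actL_comul f)]; rfl
  rw [h, whisker_exchange_assoc, leftUnitor_naturality]
  simp only [actR, Category.assoc]

lemma actL_counit : actL (ε[D]) = 𝟙 D := by simp [actL]

lemma actR_counit : actR (ε[D]) = 𝟙 D := by simp [actR]

lemma actL_add [Preadditive C] [MonoidalPreadditive C] : actL (f + g) = actL f + actL g := by
  simp [actL]

lemma actR_add [Preadditive C] [MonoidalPreadditive C] : actR (f + g) = actR f + actR g := by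
  simp [actR]

lemma actL_zero [Preadditive C] [MonoidalPreadditive C] : actL (0 : D ⟶ 𝟙_ C) = 0 := by
  simp [actL]

lemma actR_zero [Preadditive C] [MonoidalPreadditive C] : actR (0 : D ⟶ 𝟙_ C) = 0 := by
  simp [actR]

/-- Coalgebra isomorphisms intertwine the actions. -/
lemma actL_naturality {D' : C} [ComonObj D'] (e : D ⟶ D') [IsComonHom e] (f : D' ⟶ 𝟙_ C) :
    actL (e ≫ f) ≫ e = e ≫ actL f := by
  simp only [actL, Category.assoc, IsComonHom.hom_comul_assoc]
  rw [← rightUnitor_naturality, MonoidalCategory.tensorHom_def', Category.assoc,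
    MonoidalCategory.whiskerLeft_comp, Category.assoc, whisker_exchange_assoc]

lemma actR_naturality {D' : C} [ComonObj D'] (e : D ⟶ D') [IsComonHom e] (f : D' ⟶ 𝟙_ C) :
    actR (e ≫ f) ≫ e = e ≫ actR f := by
  simp only [actR, Category.assoc, IsComonHom.hom_comul_assoc]
  rw [← leftUnitor_naturality, MonoidalCategory.tensorHom_def, Category.assoc,
    comp_whiskerRight, Category.assoc, whisker_exchange_assoc]

lemma comul_tensor_balance {M N : C} (m : D ⟶ M) (n : D ⟶ N) :
    Δ[D] ≫ ((actL f ≫ m) ⊗ₘ n) = Δ[D] ≫ (m ⊗ₘ (actR f ≫ n)) := by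
  have h1 : ((actL f ≫ m) ⊗ₘ n) = actL f ▷ D ≫ (m ⊗ₘ n) := by
    simp [MonoidalCategory.tensorHom_def]
  have h2 : (m ⊗ₘ (actR f ≫ n)) = D ◁ actR f ≫ (m ⊗ₘ n) := by
    simp [MonoidalCategory.tensorHom_def']
  rw [h1, h2, reassoc_of% (comul_balance f)]

lemma comul_tensor_left {M N : C} (m : D ⟶ M) (n : D ⟶ N) :
    Δ[D] ≫ ((actR f ≫ m) ⊗ₘ n) = actR f ≫ Δ[D] ≫ (m ⊗ₘ n) := by
  have h1 : ((actR f ≫ m) ⊗ₘ n) = actR f ▷ D ≫ (m ⊗ₘ n) := by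
    simp [MonoidalCategory.tensorHom_def]
  rw [h1, reassoc_of% (actR_comul f)]

lemma comul_tensor_right {M N : C} (m : D ⟶ M) (n : D ⟶ N) :
    Δ[D] ≫ (m ⊗ₘ (actL f ≫ n)) = actL f ≫ Δ[D] ≫ (m ⊗ₘ n) := by
  have h2 : (m ⊗ₘ (actL f ≫ n)) = D ◁ actL f ≫ (m ⊗ₘ n) := by
    simp [MonoidalCategory.tensorHom_def']
  rw [h2, reassoc_of% (actL_comul f)]

lemma comul_tensor_assoc {M N P : C} (m : D ⟶ M) (n : D ⟶ N) (p : D ⟶ P) :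
    Δ[D] ≫ ((Δ[D] ≫ (m ⊗ₘ n)) ⊗ₘ p) ≫ (α_ M N P).hom =
      Δ[D] ≫ (m ⊗ₘ (Δ[D] ≫ (n ⊗ₘ p))) := by
  have h1 : ((Δ[D] ≫ (m ⊗ₘ n)) ⊗ₘ p) = Δ[D] ▷ D ≫ ((m ⊗ₘ n) ⊗ₘ p) := by
    simp [MonoidalCategory.tensorHom_def]
  have h2 : (m ⊗ₘ (Δ[D] ≫ (n ⊗ₘ p))) = D ◁ Δ[D] ≫ (m ⊗ₘ (n ⊗ₘ p)) := by
    simp [MonoidalCategory.tensorHom_def']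
  rw [h1, h2, ComonObj.comul_assoc_assoc, Category.assoc, associator_naturality]

lemma comul_tensor_unit_left {M : C} (m : D ⟶ M) :
    Δ[D] ≫ (f ⊗ₘ m) ≫ (λ_ M).hom = actR f ≫ m := by
  simp only [actR, Category.assoc, MonoidalCategory.tensorHom_def]
  rw [← leftUnitor_naturality]

lemma comul_tensor_unit_right {M : C} (m : D ⟶ M) :
    Δ[D] ≫ (m ⊗ₘ f) ≫ (ρ_ M).hom = actL f ≫ m := by
  simp only [actL, Category.assoc, MonoidalCategory.tensorHom_def']
  rw [← rightUnitor_naturality]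

end Convolution

/-! ### Convolution representations -/

/-- A convolution representation of the ring `B` over the ring `A`: a counital coalgebra `D` in
the monoidal category of `A`-bimodules (an `A`-coring), and a ring homomorphism from `B` to the
convolution ring of bimodule maps `D ⟶ A`. -/
structure ConvRep (B A : Type u) [Ring B] [Ring A] : Type (u + 1) where
  D : Comon (Bimodule A)
  hom : B →+* Conv D.X (𝟙_ (Bimodule A))

namespace ConvRep

open ComonObj

section

variable {B A : Type u} [Ring B] [Ring A] (r : ConvRep B A)

/-- The bimodule map `D ⟶ A`, `d ↦ b(d)`, given by `b : B`. -/
def ev (b : B) : r.D.X ⟶ 𝟙_ (Bimodule A) := r.hom b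

lemma ev_one : r.ev 1 = ε[r.D.X] := (map_one r.hom).trans counit_eq_one.symm

lemma ev_mul (b c : B) : r.ev (b * c) = conv (r.ev b) (r.ev c) :=
  (map_mul r.hom b c).trans (conv_eq_mul _ _).symm

lemma ev_add (b c : B) : r.ev (b + c) = r.ev b + r.ev c := map_add r.hom b c

lemma ev_zero : r.ev 0 = 0 := map_zero r.hom

/-- Two representations are isomorphic if there is an isomorphism of counital coalgebras
compatible with the homomorphisms from `B`. -/
def setoid (B A : Type u) [Ring B] [Ring A] : Setoid (ConvRep B A) where
  r r s := ∃ e : r.D ≅ s.D, ∀ b, r.ev b = e.hom.hom ≫ s.ev b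
  iseqv :=
    { refl := fun r => ⟨Iso.refl _, fun b => (Category.id_comp _).symm⟩
      symm := fun {r s} ⟨e, h⟩ => ⟨e.symm, fun b => by
        have h' : e.inv.hom ≫ e.hom.hom = 𝟙 s.D.X := congrArg Comon.Hom.hom e.inv_hom_id
        rw [h b, Iso.symm_hom, reassoc_of% h']⟩
      trans := fun ⟨e, h⟩ ⟨e', h'⟩ => ⟨e ≪≫ e', fun b => by
        rw [h b, h' b]
        exact (Category.assoc e.hom.hom e'.hom.hom _).symm⟩ }

/-! #### The direct image functor `Hom_A(D, -)_A` -/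

/-- The `B`-bimodule `Hom_A(D, M)_A`, with `(b • n)(d) = n(d · b)` and `(n • b)(d) = n(b · d)`,
where `b · d = d₍₁₎ b(d₍₂₎)` and `d · b = b(d₍₁₎) d₍₂₎`. -/
def homBimodule (M : Bimodule A) : Bimodule B :=
  letI : Module B (r.D.X ⟶ M) :=
    { smul := fun b n => actR (r.ev b) ≫ n
      one_smul := fun n => by
        change actR (r.ev 1) ≫ n = n
        rw [ev_one, actR_counit, Category.id_comp]
      mul_smul := fun b c n => by
        change actR (r.ev (b * c)) ≫ n = actR (r.ev b) ≫ actR (r.ev c) ≫ n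
        rw [ev_mul, actR_conv, Category.assoc]
      smul_zero := fun b => Limits.comp_zero
      smul_add := fun b n n' => Preadditive.comp_add _ _ _ _ _ _
      add_smul := fun b c n => by
        change actR (r.ev (b + c)) ≫ n = actR (r.ev b) ≫ n + actR (r.ev c) ≫ n
        rw [ev_add, actR_add, Preadditive.add_comp]
      zero_smul := fun n => by
        change actR (r.ev 0) ≫ n = 0
        rw [ev_zero, actR_zero, Limits.zero_comp] }
  letI : Module Bᵐᵒᵖ (r.D.X ⟶ M) :=
    { smul := fun b n => actL (r.ev b.unop) ≫ n
      one_smul := fun n => by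
        change actL (r.ev 1) ≫ n = n
        rw [ev_one, actL_counit, Category.id_comp]
      mul_smul := fun b c n => by
        change actL (r.ev (c.unop * b.unop)) ≫ n = actL (r.ev b.unop) ≫ actL (r.ev c.unop) ≫ n
        rw [ev_mul, actL_conv, Category.assoc]
      smul_zero := fun b => Limits.comp_zero
      smul_add := fun b n n' => Preadditive.comp_add _ _ _ _ _ _
      add_smul := fun b c n => by
        change actL (r.ev (b.unop + c.unop)) ≫ n = actL (r.ev b.unop) ≫ n + actL (r.ev c.unop) ≫ n
        rw [ev_add, actL_add, Preadditive.add_comp]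
      zero_smul := fun n => by
        change actL (r.ev 0) ≫ n = 0
        rw [ev_zero, actL_zero, Limits.zero_comp] }
  haveI : SMulCommClass B Bᵐᵒᵖ (r.D.X ⟶ M) := ⟨fun b c n => by
    change actR (r.ev b) ≫ actL (r.ev c.unop) ≫ n = actL (r.ev c.unop) ≫ actR (r.ev b) ≫ n
    rw [← Category.assoc, ← actL_actR, Category.assoc]⟩
  ⟨r.D.X ⟶ M⟩

/-- A bimodule map `D ⟶ M` as an element of `Hom_A(D, M)_A`. -/
def toEl {M : Bimodule A} : (r.D.X ⟶ M) ≃+ r.homBimodule M := AddEquiv.refl _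

lemma smul_toEl {M : Bimodule A} (b : B) (n : r.D.X ⟶ M) :
    b • r.toEl n = r.toEl (actR (r.ev b) ≫ n) := rfl

lemma op_smul_toEl {M : Bimodule A} (b : B) (n : r.D.X ⟶ M) :
    MulOpposite.op b • r.toEl n = r.toEl (actL (r.ev b) ≫ n) := rfl

/-- The functor `f_* M = Hom_A(D, M)_A`. -/
def directImage : Bimodule A ⥤ Bimodule B where
  obj M := r.homBimodule M
  map k :=
    { hom := AddMonoidHom.mk' (fun n => r.toEl (r.toEl.symm n ≫ k))
        (fun n n' => Preadditive.add_comp _ _ _ (r.toEl.symm n) (r.toEl.symm n') k)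
      map_left := fun b n => Category.assoc (actR (r.ev b)) (r.toEl.symm n) k
      map_right := fun b n => Category.assoc (actL (r.ev b.unop)) (r.toEl.symm n) k }
  map_id _ := Bimodule.hom_ext fun n => Category.comp_id (r.toEl.symm n)
  map_comp f g := Bimodule.hom_ext fun n => (Category.assoc (r.toEl.symm n) f g).symm

lemma directImage_map_toEl {M N : Bimodule A} (k : M ⟶ N) (n : r.D.X ⟶ M) :
    (r.directImage.map k).hom (r.toEl n) = r.toEl (n ≫ k) := rfl

instance : r.directImage.Additive where
  map_add {_ _ f g} := Bimodule.hom_ext fun n => Preadditive.comp_add _ _ _ (r.toEl.symm n) f g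

/-- The unit `B ⟶ Hom_A(D, A)_A` given by the representation. -/
def unitHom : 𝟙_ (Bimodule B) ⟶ r.directImage.obj (𝟙_ (Bimodule A)) where
  hom := (r.toEl (M := 𝟙_ (Bimodule A))).toAddMonoidHom.comp (AddMonoidHom.mk' r.ev r.ev_add)
  map_left (b : B) (c : B) := by
    change r.ev (b * c) = actR (r.ev b) ≫ r.ev c
    rw [ev_mul, actR_comp]
  map_right b (c : B) := by
    change r.ev (c * b.unop) = actL (r.ev b.unop) ≫ r.ev c
    rw [ev_mul, actL_comp]

/-- The map `n₁ ⊗ n₂ ↦ (d ↦ n₁(d₍₁₎) ⊗ n₂(d₍₂₎))`. -/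
def mulHom (M N : Bimodule A) :
    r.directImage.obj M ⊗ r.directImage.obj N ⟶ r.directImage.obj (M ⊗ N) :=
  Bimodule.tlift (M := r.homBimodule M) (N := r.homBimodule N) (P := r.homBimodule (M ⊗ N))
    (Bimodule.biadd
      (fun m n => r.toEl (Δ[r.D.X] ≫ (r.toEl.symm m ⊗ₘ r.toEl.symm n)))
      (fun m m' n => by
        rw [map_add, MonoidalPreadditive.add_tensor, Preadditive.comp_add, map_add])
      (fun m n n' => by
        rw [map_add, MonoidalPreadditive.tensor_add, Preadditive.comp_add, map_add]))
    (fun b m n => by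
      change Δ[r.D.X] ≫ ((actL (r.ev b) ≫ r.toEl.symm m) ⊗ₘ r.toEl.symm n) =
        Δ[r.D.X] ≫ (r.toEl.symm m ⊗ₘ (actR (r.ev b) ≫ r.toEl.symm n))
      exact comul_tensor_balance _ _ _)
    (fun b m n => by
      change Δ[r.D.X] ≫ ((actR (r.ev b) ≫ r.toEl.symm m) ⊗ₘ r.toEl.symm n) =
        actR (r.ev b) ≫ Δ[r.D.X] ≫ (r.toEl.symm m ⊗ₘ r.toEl.symm n)
      exact comul_tensor_left _ _ _)
    (fun b m n => by
      change Δ[r.D.X] ≫ (r.toEl.symm m ⊗ₘ (actL (r.ev b.unop) ≫ r.toEl.symm n)) =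
        actL (r.ev b.unop) ≫ Δ[r.D.X] ≫ (r.toEl.symm m ⊗ₘ r.toEl.symm n)
      exact comul_tensor_right _ _ _)

lemma mulHom_tmul {M N : Bimodule A} (m : r.D.X ⟶ M) (n : r.D.X ⟶ N) :
    (r.mulHom M N).hom (Bimodule.tmul (M := r.homBimodule M) (N := r.homBimodule N)
      (r.toEl m) (r.toEl n)) = r.toEl (Δ[r.D.X] ≫ (m ⊗ₘ n)) := rfl

end

end ConvRep

namespace ConvRep

section

variable {B A : Type u} [Ring B] [Ring A] (r : ConvRep B A)

/-- The monoidal structure of `f_*`. -/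
instance : r.directImage.LaxMonoidal where
  ε := r.unitHom
  μ := r.mulHom
  μ_natural_left {M N} k P := Bimodule.tensor_ext fun (m : r.homBimodule M)
      (p : r.homBimodule P) => by
    change ComonObj.comul (X := r.D.X) ≫ ((r.toEl.symm m ≫ k) ⊗ₘ r.toEl.symm p) =
      (ComonObj.comul (X := r.D.X) ≫ (r.toEl.symm m ⊗ₘ r.toEl.symm p)) ≫ k ▷ P
    simp [MonoidalCategory.tensorHom_def']
  μ_natural_right {M N} P k := Bimodule.tensor_ext fun (p : r.homBimodule P)
      (m : r.homBimodule M) => by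
    change ComonObj.comul (X := r.D.X) ≫ (r.toEl.symm p ⊗ₘ (r.toEl.symm m ≫ k)) =
      (ComonObj.comul (X := r.D.X) ≫ (r.toEl.symm p ⊗ₘ r.toEl.symm m)) ≫ P ◁ k
    simp [MonoidalCategory.tensorHom_def]
  associativity M N P := Bimodule.tensor_ext_left fun (m : r.homBimodule M)
      (n : r.homBimodule N) (p : r.homBimodule P) => by
    change (ComonObj.comul (X := r.D.X) ≫ ((ComonObj.comul (X := r.D.X) ≫ (r.toEl.symm m ⊗ₘ r.toEl.symm n)) ⊗ₘ r.toEl.symm p)) ≫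
      (α_ M N P).hom =
        ComonObj.comul (X := r.D.X) ≫ (r.toEl.symm m ⊗ₘ (ComonObj.comul (X := r.D.X) ≫ (r.toEl.symm n ⊗ₘ r.toEl.symm p)))
    rw [Category.assoc, comul_tensor_assoc]
  left_unitality M := Bimodule.tensor_ext fun (b : B) (m : r.homBimodule M) => by
    change actR (r.ev b) ≫ r.toEl.symm m =
      (ComonObj.comul (X := r.D.X) ≫ (r.ev b ⊗ₘ r.toEl.symm m)) ≫ (λ_ M).hom
    rw [Category.assoc, comul_tensor_unit_left]
  right_unitality M := Bimodule.tensor_ext fun (m : r.homBimodule M) (b : B) => by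
    change actL (r.ev b) ≫ r.toEl.symm m =
      (ComonObj.comul (X := r.D.X) ≫ (r.toEl.symm m ⊗ₘ r.ev b)) ≫ (ρ_ M).hom
    rw [Category.assoc, comul_tensor_unit_right]

/-! #### The inverse image functor `- ⊗_{Bᵒ ⊗ B} D` -/

/-- Right multiplication of the generators of `Bᵒ ⊗ B` on a `B`-bimodule `N`. -/
def envR (N : Bimodule B) : B ⊕ B → N →+ N := Sum.elim N.rmul N.lmul

/-- Left multiplication of the generators of `Bᵒ ⊗ B` on `D`. -/
def envL : B ⊕ B → r.D.X →+ r.D.X :=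
  Sum.elim (fun b => (actL (r.ev b)).hom) (fun b => (actR (r.ev b)).hom)

/-- The `A`-bimodule `N ⊗_{Bᵒ ⊗ B} D`: the quotient of `N ⊗ D` by the relations
`(n • b) ⊗ d = n ⊗ (b · d)` and `(b • n) ⊗ d = n ⊗ (d · b)`, with the `A`-actions on `D`. -/
def tensorBimodule (N : Bimodule B) : Bimodule A :=
  letI : Module A (Bal (envR N) r.envL) := Bal.moduleRight fun i a d => by
    rcases i with b | b
    · exact (actL (r.ev b)).map_left a d
    · exact (actR (r.ev b)).map_left a d
  letI : Module Aᵐᵒᵖ (Bal (envR N) r.envL) := Bal.moduleRight fun i a d => by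
    rcases i with b | b
    · exact (actL (r.ev b)).map_right a d
    · exact (actR (r.ev b)).map_right a d
  haveI : SMulCommClass A Aᵐᵒᵖ (Bal (envR N) r.envL) := ⟨fun a b x => by
    induction x using Bal.induction with
    | zero => simp
    | tm n d => exact congrArg (Bal.tmul (envR N) r.envL n) (smul_comm a b d)
    | add x y hx hy => simp only [smul_add, hx, hy]⟩
  ⟨Bal (envR N) r.envL⟩

/-- The map `D ⟶ N ⊗_{Bᵒ ⊗ B} D`, `d ↦ n ⊗ d`. -/
def tensorIns {N : Bimodule B} (n : N) : r.D.X ⟶ r.tensorBimodule N where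
  hom := Bal.tmulHom (envR N) r.envL n
  map_left _ _ := rfl
  map_right _ _ := rfl

lemma tensorIns_add {N : Bimodule B} (n n' : N) : r.tensorIns (n + n') = r.tensorIns n + r.tensorIns n' :=
  Bimodule.hom_ext fun d => Bal.add_tmul n n' d

lemma tensorIns_zero {N : Bimodule B} : r.tensorIns (0 : N) = 0 :=
  Bimodule.hom_ext fun d => Bal.zero_tmul d

lemma tensorIns_smul {N : Bimodule B} (b : B) (n : N) :
    r.tensorIns (b • n) = actR (r.ev b) ≫ r.tensorIns n :=
  Bimodule.hom_ext fun d => Bal.balance (r := envR N) (l := r.envL) (Sum.inr b) n d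

lemma tensorIns_op_smul {N : Bimodule B} (b : Bᵐᵒᵖ) (n : N) :
    r.tensorIns (b • n) = actL (r.ev b.unop) ≫ r.tensorIns n :=
  Bimodule.hom_ext fun d => Bal.balance (r := envR N) (l := r.envL) (Sum.inl b.unop) n d

lemma tensorIns_ext {N : Bimodule B} {M : Bimodule A} {f g : r.tensorBimodule N ⟶ M}
    (h : ∀ n : N, r.tensorIns n ≫ f = r.tensorIns n ≫ g) : f = g :=
  Bimodule.Hom.ext (Bal.hom_ext fun n d => congrArg (fun k => Bimodule.Hom.hom k d) (h n))

/-- Maps out of `N ⊗_{Bᵒ ⊗ B} D`, as additive maps. -/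
def descAdd {N : Bimodule B} {M : Bimodule A} (k : N ⟶ r.homBimodule M) :
    r.tensorBimodule N →+ M :=
  Bal.lift (r := envR N) (l := r.envL)
    (AddMonoidHom.mk' (fun n => (r.toEl.symm (k.hom n)).hom) (fun n n' => by
      rw [map_add, map_add]; rfl))
    (fun i n d => by
      rcases i with b | b
      · exact congrArg (fun n => (r.toEl.symm n).hom d) (k.map_right (MulOpposite.op b) n)
      · exact congrArg (fun n => (r.toEl.symm n).hom d) (k.map_left b n))

/-- The tensor-hom adjunction: the map `n ⊗ d ↦ k(n)(d)`. -/
def desc {N : Bimodule B} {M : Bimodule A} (k : N ⟶ r.homBimodule M) :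
    r.tensorBimodule N ⟶ M where
  hom := r.descAdd k
  map_left a x := by
    induction x using Bal.induction (r := envR N) (l := r.envL) with
    | zero =>
      exact (congrArg _ (smul_zero (A := r.tensorBimodule N) a)).trans
        ((map_zero (r.descAdd k)).trans
          ((congrArg _ (map_zero (r.descAdd k))).trans (smul_zero a)).symm)
    | tm n d => exact (r.toEl.symm (k.hom n)).map_left a d
    | add x y hx hy =>
      exact (congrArg _ (smul_add (A := r.tensorBimodule N) a x y)).trans
        ((map_add (r.descAdd k) _ _).trans ((congrArg₂ (· + ·) hx hy).trans
          ((smul_add a _ _).symm.trans (congrArg _ (map_add (r.descAdd k) x y).symm))))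
  map_right a x := by
    induction x using Bal.induction (r := envR N) (l := r.envL) with
    | zero =>
      exact (congrArg _ (smul_zero (A := r.tensorBimodule N) a)).trans
        ((map_zero (r.descAdd k)).trans
          ((congrArg _ (map_zero (r.descAdd k))).trans (smul_zero a)).symm)
    | tm n d => exact (r.toEl.symm (k.hom n)).map_right a d
    | add x y hx hy =>
      exact (congrArg _ (smul_add (A := r.tensorBimodule N) a x y)).trans
        ((map_add (r.descAdd k) _ _).trans ((congrArg₂ (· + ·) hx hy).trans
          ((smul_add a _ _).symm.trans (congrArg _ (map_add (r.descAdd k) x y).symm))))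

lemma tensorIns_desc {N : Bimodule B} {M : Bimodule A} (k : N ⟶ r.homBimodule M) (n : N) :
    r.tensorIns n ≫ r.desc k = r.toEl.symm (k.hom n) := rfl

/-- The unit `N ⟶ Hom_A(D, N ⊗_{Bᵒ ⊗ B} D)_A`, `n ↦ (d ↦ n ⊗ d)`, of the adjunction. -/
def insHom (N : Bimodule B) : N ⟶ r.homBimodule (r.tensorBimodule N) where
  hom := AddMonoidHom.mk' (fun n => r.toEl (r.tensorIns n)) (fun n n' => by rw [tensorIns_add, map_add])
  map_left b n := congrArg r.toEl (r.tensorIns_smul b n)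
  map_right b n := congrArg r.toEl (r.tensorIns_op_smul b n)

/-- The functor `f^* N = N ⊗_{Bᵒ ⊗ B} D`. -/
def inverseImage : Bimodule B ⥤ Bimodule A where
  obj N := r.tensorBimodule N
  map k := r.desc (k ≫ r.insHom _)
  map_id _ := r.tensorIns_ext fun _ => rfl
  map_comp _ _ := r.tensorIns_ext fun _ => rfl

/-- The map `D ⟶ f^* N`, `d ↦ n ⊗ d`. -/
def ins {N : Bimodule B} (n : N) : r.D.X ⟶ r.inverseImage.obj N := r.tensorIns n

lemma ins_add {N : Bimodule B} (n n' : N) : r.ins (n + n') = r.ins n + r.ins n' :=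
  r.tensorIns_add n n'

lemma ins_zero {N : Bimodule B} : r.ins (0 : N) = 0 := r.tensorIns_zero

lemma ins_ext {N : Bimodule B} {M : Bimodule A} {f g : r.inverseImage.obj N ⟶ M}
    (h : ∀ n : N, r.ins n ≫ f = r.ins n ≫ g) : f = g := r.tensorIns_ext h

lemma ins_map {N N' : Bimodule B} (k : N ⟶ N') (n : N) :
    r.ins n ≫ r.inverseImage.map k = r.ins (k.hom n) := rfl

/-- The adjunction between `f^*` and `f_*`. -/
def adj : r.inverseImage ⊣ r.directImage :=
  Adjunction.mkOfHomEquiv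
    { homEquiv := fun N _ =>
        { toFun := fun k => r.insHom N ≫ r.directImage.map k
          invFun := fun k => r.desc k
          left_inv := fun _ => r.tensorIns_ext fun _ => rfl
          right_inv := fun _ => Bimodule.hom_ext fun _ => rfl }
      homEquiv_naturality_left_symm := fun _ _ => r.tensorIns_ext fun _ => rfl
      homEquiv_naturality_right := fun _ _ => Bimodule.hom_ext fun _ => rfl }

instance : r.directImage.IsRightAdjoint := r.adj.isRightAdjoint

instance : r.inverseImage.Additive := r.adj.left_adjoint_additive

/-- The comonoidal structure of `f^*` that corresponds to the monoidal structure of `f_*`; see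
`ins_δ` and `ins_η` for the formulas. -/
instance : r.inverseImage.OplaxMonoidal := r.adj.leftAdjointOplaxMonoidal

open Functor.OplaxMonoidal

/-- `f^*(N ⊗ N') ⟶ f^* N ⊗ f^* N'` maps `(n ⊗ n') ⊗ d` to `(n ⊗ d₍₁₎) ⊗ (n' ⊗ d₍₂₎)`. -/
lemma ins_δ {N N' : Bimodule B} (n : N) (n' : N') :
    r.ins (Bimodule.tmul n n') ≫ δ r.inverseImage N N' = ComonObj.comul (X := r.D.X) ≫ (r.ins n ⊗ₘ r.ins n') := rfl

/-- `f^* B ⟶ A` maps `b ⊗ d` to `b(d)`. -/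
lemma ins_η (b : B) : r.ins (N := 𝟙_ (Bimodule B)) b ≫ η r.inverseImage = r.ev b := rfl

end

end ConvRep

/-! ### Composition and identities of convolution representations -/

/-- Comonoidal functors are compatible with convolution. -/
lemma map_conv {C : Type u} [Category.{v} C] [MonoidalCategory C] {C' : Type u} [Category.{v} C']
    [MonoidalCategory C'] (L : C ⥤ C') [L.OplaxMonoidal] (D : Comon C) (f g : D.X ⟶ 𝟙_ C) :
    L.map (conv f g) ≫ Functor.OplaxMonoidal.η L =
      conv (D := (L.mapComon.obj D).X) (L.map f ≫ Functor.OplaxMonoidal.η L)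
        (L.map g ≫ Functor.OplaxMonoidal.η L) := by
  have h : conv (D := (L.mapComon.obj D).X) (L.map f ≫ Functor.OplaxMonoidal.η L)
        (L.map g ≫ Functor.OplaxMonoidal.η L) =
      (L.map ComonObj.comul ≫ Functor.OplaxMonoidal.δ L D.X D.X) ≫
        ((L.map f ≫ Functor.OplaxMonoidal.η L) ⊗ₘ (L.map g ≫ Functor.OplaxMonoidal.η L)) ≫
          (λ_ (𝟙_ C')).hom := rfl
  have h1 := Functor.OplaxMonoidal.left_unitality_hom L (𝟙_ C)
  have h2 : (Functor.OplaxMonoidal.η L ⊗ₘ Functor.OplaxMonoidal.η L) ≫ (λ_ (𝟙_ C')).hom =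
      Functor.OplaxMonoidal.η L ▷ L.obj (𝟙_ C) ≫ (λ_ (L.obj (𝟙_ C))).hom ≫
        Functor.OplaxMonoidal.η L := by
    rw [MonoidalCategory.tensorHom_def, Category.assoc, leftUnitor_naturality]
  rw [h, conv, L.map_comp, L.map_comp, ← h1, ← MonoidalCategory.tensorHom_comp_tensorHom]
  simp only [Category.assoc]
  rw [h2, Functor.OplaxMonoidal.δ_natural_assoc]

section Free

variable (A : Type u) [Ring A]

/-- The `A`-bimodule `A ⊗ A` (tensor product of abelian groups, with no relations added), with
`a (x ⊗ y) a' = (a x) ⊗ (y a')`. -/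
def freeBimodule : Bimodule A :=
  letI : Module A (Bal (ι := Empty) (M := A) (N := A) Empty.elim Empty.elim) :=
    Bal.moduleLeft fun i => i.elim
  letI : Module Aᵐᵒᵖ (Bal (ι := Empty) (M := A) (N := A) Empty.elim Empty.elim) :=
    Bal.moduleRight fun i => i.elim
  haveI : SMulCommClass A Aᵐᵒᵖ (Bal (ι := Empty) (M := A) (N := A) Empty.elim Empty.elim) :=
    ⟨fun a b x => by
      induction x using Bal.induction with
      | zero => simp
      | tm m n => rfl
      | add x y hx hy => simp only [smul_add, hx, hy]⟩
  ⟨Bal (ι := Empty) (M := A) (N := A) Empty.elim Empty.elim⟩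

variable {A}

/-- The element `x ⊗ y` of `A ⊗ A`. -/
def freeTmul (x y : A) : freeBimodule A := Bal.tmul (ι := Empty) Empty.elim Empty.elim x y

lemma smul_freeTmul (a x y : A) : a • freeTmul x y = freeTmul (a * x) y := rfl

lemma op_smul_freeTmul (a : Aᵐᵒᵖ) (x y : A) : a • freeTmul x y = freeTmul x (y * a.unop) := rfl

lemma free_ext {M : Bimodule A} {f g : freeBimodule A ⟶ M}
    (h : f.hom (freeTmul 1 1) = g.hom (freeTmul 1 1)) : f = g := by
  have key : ∀ x y : A, f.hom (freeTmul x y) = g.hom (freeTmul x y) := fun x y => by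
    have e : freeTmul x y = x • MulOpposite.op y • freeTmul (1 : A) 1 := by
      rw [op_smul_freeTmul, smul_freeTmul, mul_one, MulOpposite.unop_op, one_mul]
    rw [e, f.map_left, f.map_right, g.map_left, g.map_right, h]
  refine Bimodule.hom_ext fun t => ?_
  induction t using Bal.induction (ι := Empty) (r := Empty.elim) (l := Empty.elim) with
  | zero => exact (map_zero f.hom).trans (map_zero g.hom).symm
  | tm x y => exact key x y
  | add s t hs ht =>
    exact (map_add f.hom s t).trans ((congrArg₂ (· + ·) hs ht).trans (map_add g.hom s t).symm)

/-- The additive map `x ⊗ y ↦ x m y`. -/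
def freeLiftAdd {M : Bimodule A} (m : M) : freeBimodule A →+ M :=
  Bal.lift (ι := Empty) (M := A) (N := A) (r := Empty.elim) (l := Empty.elim)
    (Bimodule.biadd (fun x y : A => x • MulOpposite.op y • m) (fun x x' y => add_smul x x' _)
      (fun x y y' => by rw [MulOpposite.op_add, add_smul, smul_add]))
    (fun i => i.elim)

/-- The bimodule map `A ⊗ A ⟶ M`, `x ⊗ y ↦ x m y`. -/
def freeLift {M : Bimodule A} (m : M) : freeBimodule A ⟶ M where
  hom := freeLiftAdd m
  map_left a t := by
    induction t using Bal.induction (ι := Empty) (r := Empty.elim) (l := Empty.elim) with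
    | zero =>
      exact (congrArg _ (smul_zero (A := freeBimodule A) a)).trans
        ((map_zero (freeLiftAdd m)).trans
          ((congrArg _ (map_zero (freeLiftAdd m))).trans (smul_zero a)).symm)
    | tm x y => exact mul_smul a x (MulOpposite.op y • m)
    | add s t hs ht =>
      exact (congrArg _ (smul_add (A := freeBimodule A) a s t)).trans
        ((map_add (freeLiftAdd m) _ _).trans ((congrArg₂ (· + ·) hs ht).trans
          ((smul_add a _ _).symm.trans (congrArg _ (map_add (freeLiftAdd m) s t).symm))))
  map_right a t := by
    induction t using Bal.induction (ι := Empty) (r := Empty.elim) (l := Empty.elim) with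
    | zero =>
      exact (congrArg _ (smul_zero (A := freeBimodule A) a)).trans
        ((map_zero (freeLiftAdd m)).trans
          ((congrArg _ (map_zero (freeLiftAdd m))).trans (smul_zero a)).symm)
    | tm x y =>
      exact (congrArg (x • ·) (mul_smul a (MulOpposite.op y) m)).trans
        (smul_comm x a (MulOpposite.op y • m))
    | add s t hs ht =>
      exact (congrArg _ (smul_add (A := freeBimodule A) a s t)).trans
        ((map_add (freeLiftAdd m) _ _).trans ((congrArg₂ (· + ·) hs ht).trans
          ((smul_add a _ _).symm.trans (congrArg _ (map_add (freeLiftAdd m) s t).symm))))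

lemma freeLift_tmul {M : Bimodule A} (m : M) (x y : A) :
    (freeLift m).hom (freeTmul x y) = x • MulOpposite.op y • m := rfl

lemma freeLift_one {M : Bimodule A} (m : M) : (freeLift m).hom (freeTmul 1 1) = m := by
  rw [freeLift_tmul, MulOpposite.op_one, one_smul, one_smul]

/-- The coalgebra `A ⊗ A`, with counit `x ⊗ y ↦ x y` and comultiplication
`x ⊗ y ↦ (x ⊗ 1) ⊗ (1 ⊗ y)`. -/
instance : ComonObj (freeBimodule A) where
  counit := freeLift (M := Bimodule.regular A) (1 : A)
  comul := freeLift (Bimodule.tmul (freeTmul 1 1) (freeTmul 1 1))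
  counit_comul := free_ext (by
    rw [Bimodule.comp_hom, freeLift_one]
    exact congrArg (fun a => Bimodule.tmul a (freeTmul 1 1))
      (freeLift_one (M := Bimodule.regular A) (1 : A)))
  comul_counit := free_ext (by
    rw [Bimodule.comp_hom, freeLift_one]
    exact congrArg (fun a => Bimodule.tmul (freeTmul 1 1) a)
      (freeLift_one (M := Bimodule.regular A) (1 : A)))
  comul_assoc := free_ext (by
    rw [Bimodule.comp_hom, Bimodule.comp_hom, freeLift_one]
    rw [Bimodule.comp_hom]
    have h := freeLift_one (Bimodule.tmul (freeTmul (1 : A) 1) (freeTmul (1 : A) 1))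
    exact (congrArg (fun a => Bimodule.tmul (freeTmul 1 1) a) h).trans
      (congrArg (fun a => (Bimodule.assocHom (freeBimodule A) (freeBimodule A)
        (freeBimodule A)).hom (Bimodule.tmul a (freeTmul 1 1))) h).symm)

end Free

namespace ConvRep

variable {F B A : Type u} [Ring F] [Ring B] [Ring A]

/-- The identity representation `A = Hom_A(A ⊗ A, A)_A`, `a ↦ (x ⊗ y ↦ x a y)`. -/
def id (A : Type u) [Ring A] : ConvRep A A where
  D := ⟨freeBimodule A⟩
  hom := RingHom.mk'
    { toFun := fun a => freeLift (M := Bimodule.regular A) a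
      map_one' := counit_eq_one (D := freeBimodule A)
      map_mul' := fun a b => by
        refine Eq.trans ?_ (conv_eq_mul (D := freeBimodule A) _ _)
        refine free_ext ?_
        refine (freeLift_one (M := Bimodule.regular A) (a * b : A)).trans ?_
        have h : (conv (D := freeBimodule A) (freeLift (M := Bimodule.regular A) a)
            (freeLift (M := Bimodule.regular A) b)).hom (freeTmul 1 1) =
            (λ_ (𝟙_ (Bimodule A))).hom.hom (Bimodule.tmul
              ((freeLift (M := Bimodule.regular A) a).hom (freeTmul 1 1))
              ((freeLift (M := Bimodule.regular A) b).hom (freeTmul 1 1))) :=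
          congrArg (fun t => (λ_ (𝟙_ (Bimodule A))).hom.hom
            ((freeLift (M := Bimodule.regular A) a ⊗ₘ
              freeLift (M := Bimodule.regular A) b).hom t))
            (freeLift_one (Bimodule.tmul (freeTmul (1 : A) 1) (freeTmul (1 : A) 1)))
        exact (h.trans (congrArg₂ (fun x y => (λ_ (𝟙_ (Bimodule A))).hom.hom (Bimodule.tmul x y))
          (freeLift_one (M := Bimodule.regular A) a)
          (freeLift_one (M := Bimodule.regular A) b))).symm }
    (fun a b => free_ext (by
      refine (freeLift_one (M := Bimodule.regular A) (a + b : A)).trans ?_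
      exact (congrArg₂ (fun x y : A => x + y) (freeLift_one (M := Bimodule.regular A) a)
        (freeLift_one (M := Bimodule.regular A) b)).symm))

/-- Transport of a representation of `F` over `B` along an additive comonoidal functor
`L : Bimod(B) ⥤ Bimod(A)`: the coalgebra `L(E)` with the composite
`F → Hom_B(E, B)_B → Hom_A(L(E), L(B))_A → Hom_A(L(E), A)_A`. -/
def transport (s : ConvRep F B) (L : Bimodule B ⥤ Bimodule A) [L.Additive] [L.OplaxMonoidal] :
    ConvRep F A where
  D := L.mapComon.obj s.D
  hom := RingHom.mk'
    { toFun := fun x => L.map (s.ev x) ≫ Functor.OplaxMonoidal.η L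
      map_one' := by
        rw [ev_one]
        exact counit_eq_one (D := (L.mapComon.obj s.D).X)
      map_mul' := fun x y =>
        (congrArg (fun k => L.map k ≫ Functor.OplaxMonoidal.η L) (s.ev_mul x y)).trans
          ((map_conv L s.D _ _).trans (conv_eq_mul (D := (L.mapComon.obj s.D).X) _ _)) }
    (fun x y =>
      (congrArg (fun k => L.map k ≫ Functor.OplaxMonoidal.η L) (s.ev_add x y)).trans
        ((congrArg (fun k => k ≫ Functor.OplaxMonoidal.η L) L.map_add).trans
          (Preadditive.add_comp _ _ _ _ _ _)))

/-- The composite of the representations `F → Hom_B(E, B)_B` and `B → Hom_A(D, A)_A`, given by the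
coalgebra `E ⊗_{Bᵒ ⊗ B} D` with counit `e ⊗ d ↦ ε(e)(d)`, comultiplication
`e ⊗ d ↦ (e₍₁₎ ⊗ d₍₁₎) ⊗ (e₍₂₎ ⊗ d₍₂₎)`, and the homomorphism `x ↦ (e ⊗ d ↦ x(e)(d))`. -/
def comp (s : ConvRep F B) (r : ConvRep B A) : ConvRep F A := s.transport r.inverseImage

lemma comp_ev (s : ConvRep F B) (r : ConvRep B A) (x : F) (e : s.D.X) :
    r.ins e ≫ (s.comp r).ev x = r.ev ((s.ev x).hom e : B) := rfl

/-- The representation of `B` over `A` associated with an additive comonoidal functor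
`L : Bimod(B) ⥤ Bimod(A)`: the coalgebra `L(B ⊗ B)` with the composite
`B = Hom_B(B ⊗ B, B)_B → Hom_A(L(B ⊗ B), L(B))_A → Hom_A(L(B ⊗ B), A)_A`. -/
def ofInverseImage (L : Bimodule B ⥤ Bimodule A) [L.Additive] [L.OplaxMonoidal] : ConvRep B A :=
  (ConvRep.id B).transport L

end ConvRep

namespace ConvRep

variable {F B A : Type u} [Ring F] [Ring B] [Ring A]

section Iso

variable {r s : ConvRep B A} (e : r.D ≅ s.D) (h : ∀ b, r.ev b = e.hom.hom ≫ s.ev b)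

/-- Precomposition with an isomorphism of representations. -/
def homMap (M : Bimodule A) : s.homBimodule M ⟶ r.homBimodule M where
  hom := AddMonoidHom.mk' (fun n => r.toEl (e.hom.hom ≫ s.toEl.symm n))
    (fun n n' => Preadditive.comp_add _ _ _ e.hom.hom (s.toEl.symm n) (s.toEl.symm n'))
  map_left b n := by
    change e.hom.hom ≫ actR (s.ev b) ≫ s.toEl.symm n = actR (r.ev b) ≫ e.hom.hom ≫ s.toEl.symm n
    rw [← Category.assoc, ← actR_naturality, ← h, Category.assoc]
  map_right b n := by
    change e.hom.hom ≫ actL (s.ev b.unop) ≫ s.toEl.symm n =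
      actL (r.ev b.unop) ≫ e.hom.hom ≫ s.toEl.symm n
    rw [← Category.assoc, ← actL_naturality, ← h, Category.assoc]

lemma hom_inv : e.hom.hom ≫ e.inv.hom = 𝟙 r.D.X := congrArg Comon.Hom.hom e.hom_inv_id

lemma inv_hom : e.inv.hom ≫ e.hom.hom = 𝟙 s.D.X := congrArg Comon.Hom.hom e.inv_hom_id

lemma inv_compat (h : ∀ b, r.ev b = e.hom.hom ≫ s.ev b) (b : B) : s.ev b = e.inv.hom ≫ r.ev b := by
  rw [h, reassoc_of% inv_hom e]

/-- Isomorphic representations have isomorphic direct image functors. -/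
def directImageIso : r.directImage ≅ s.directImage :=
  NatIso.ofComponents (fun M =>
    { hom := homMap e.symm (inv_compat e h) M
      inv := homMap e h M
      hom_inv_id := Bimodule.hom_ext fun n => by
        change e.hom.hom ≫ e.inv.hom ≫ r.toEl.symm n = r.toEl.symm n
        rw [reassoc_of% hom_inv e]
      inv_hom_id := Bimodule.hom_ext fun n => by
        change e.inv.hom ≫ e.hom.hom ≫ s.toEl.symm n = s.toEl.symm n
        rw [reassoc_of% inv_hom e] })
    (fun f => Bimodule.hom_ext fun n => (Category.assoc e.inv.hom (r.toEl.symm n) f).symm)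

lemma directImageIso_isMonoidal : NatTrans.IsMonoidal (directImageIso e h).hom where
  unit := Bimodule.hom_ext fun (b : B) => (inv_compat e h b).symm
  tensor M N := Bimodule.tensor_ext fun (m : r.homBimodule M) (n : r.homBimodule N) => by
    change e.inv.hom ≫ ComonObj.comul ≫ (r.toEl.symm m ⊗ₘ r.toEl.symm n) =
      ComonObj.comul ≫ ((e.inv.hom ≫ r.toEl.symm m) ⊗ₘ (e.inv.hom ≫ r.toEl.symm n))
    rw [IsComonHom.hom_comul_assoc, MonoidalCategory.tensorHom_comp_tensorHom]

/-- Isomorphic representations have isomorphic inverse images. -/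
def tensorMap (N : Bimodule B) : r.inverseImage.obj N ⟶ s.inverseImage.obj N :=
  r.desc (s.insHom N ≫ homMap e h _)

lemma ins_tensorMap {N : Bimodule B} (n : N) :
    r.ins n ≫ tensorMap e h N = e.hom.hom ≫ s.ins n := rfl

lemma tensorMap_δ (N N' : Bimodule B) :
    tensorMap e h (N ⊗ N') ≫ Functor.OplaxMonoidal.δ s.inverseImage N N' =
      Functor.OplaxMonoidal.δ r.inverseImage N N' ≫ (tensorMap e h N ⊗ₘ tensorMap e h N') := by
  refine r.ins_ext fun x => ?_
  induction x using Bimodule.tensor_induction with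
  | zero => rw [ins_zero, Limits.zero_comp, Limits.zero_comp]
  | tm n n' =>
    have h1 := (reassoc_of% (r.ins_δ n n')) (tensorMap e h N ⊗ₘ tensorMap e h N')
    have h2 : r.ins (Bimodule.tmul n n') ≫ tensorMap e h (N ⊗ N') ≫
        Functor.OplaxMonoidal.δ s.inverseImage N N' =
        e.hom.hom ≫ ComonObj.comul ≫ (s.ins n ⊗ₘ s.ins n') := rfl
    rw [h1, h2, MonoidalCategory.tensorHom_comp_tensorHom, ins_tensorMap, ins_tensorMap,
      IsComonHom.hom_comul_assoc, MonoidalCategory.tensorHom_comp_tensorHom]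
  | add x y hx hy => rw [ins_add, Preadditive.add_comp, Preadditive.add_comp, hx, hy]

lemma tensorMap_naturality {N N' : Bimodule B} (k : N ⟶ N') :
    r.inverseImage.map k ≫ tensorMap e h N' = tensorMap e h N ≫ s.inverseImage.map k :=
  r.ins_ext fun _ => rfl

lemma tensorMap_η :
    tensorMap e h (𝟙_ (Bimodule B)) ≫ Functor.OplaxMonoidal.η s.inverseImage =
      Functor.OplaxMonoidal.η r.inverseImage :=
  r.ins_ext fun (b : B) => (h b).symm

/-- `tensorMap` on coalgebras. -/
def tensorComonIso (E : Comon (Bimodule B)) :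
    r.inverseImage.mapComon.obj E ≅ s.inverseImage.mapComon.obj E :=
  Comon.mkIso
    { hom := tensorMap e h E.X
      inv := tensorMap e.symm (inv_compat e h) E.X
      hom_inv_id := r.ins_ext fun n => by
        have h1 : r.ins n ≫ tensorMap e h E.X ≫ tensorMap e.symm (inv_compat e h) E.X =
          e.hom.hom ≫ e.inv.hom ≫ r.ins n := rfl
        exact h1.trans (((reassoc_of% (hom_inv e)) (r.ins n)).trans (Category.comp_id _).symm)
      inv_hom_id := s.ins_ext fun n => by
        have h1 : s.ins n ≫ tensorMap e.symm (inv_compat e h) E.X ≫ tensorMap e h E.X =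
          e.inv.hom ≫ e.hom.hom ≫ s.ins n := rfl
        exact h1.trans (((reassoc_of% (inv_hom e)) (s.ins n)).trans (Category.comp_id _).symm) }
    (by
      change tensorMap e h E.X ≫ s.inverseImage.map ComonObj.counit ≫
        Functor.OplaxMonoidal.η s.inverseImage = r.inverseImage.map ComonObj.counit ≫
        Functor.OplaxMonoidal.η r.inverseImage
      rw [← tensorMap_η e h, ← Category.assoc, ← tensorMap_naturality, Category.assoc])
    (by
      change tensorMap e h E.X ≫ s.inverseImage.map ComonObj.comul ≫
        Functor.OplaxMonoidal.δ s.inverseImage E.X E.X = (r.inverseImage.map ComonObj.comul ≫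
        Functor.OplaxMonoidal.δ r.inverseImage E.X E.X) ≫
          (tensorMap e h E.X ⊗ₘ tensorMap e h E.X)
      rw [Category.assoc, ← tensorMap_δ e h, ← Category.assoc, ← tensorMap_naturality,
        Category.assoc])

end Iso

lemma comp_congr {s s' : ConvRep F B} {r r' : ConvRep B A} (hs : ConvRep.setoid F B s s')
    (hr : ConvRep.setoid B A r r') : ConvRep.setoid F A (s.comp r) (s'.comp r') := by
  obtain ⟨d, hd⟩ := hs
  obtain ⟨e, he⟩ := hr
  refine (ConvRep.setoid F A).trans (b := s'.comp r)
    ⟨r.inverseImage.mapComon.mapIso d, fun x => ?_⟩ ⟨tensorComonIso e he s'.D, fun x => ?_⟩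
  · change r.inverseImage.map (s.ev x) ≫ Functor.OplaxMonoidal.η r.inverseImage =
      r.inverseImage.map d.hom.hom ≫ r.inverseImage.map (s'.ev x) ≫
        Functor.OplaxMonoidal.η r.inverseImage
    rw [hd, Functor.map_comp, Category.assoc]
  · change r.inverseImage.map (s'.ev x) ≫ Functor.OplaxMonoidal.η r.inverseImage =
      tensorMap e he s'.D.X ≫ r'.inverseImage.map (s'.ev x) ≫
        Functor.OplaxMonoidal.η r'.inverseImage
    rw [← tensorMap_η e he, ← Category.assoc, tensorMap_naturality, Category.assoc]

end ConvRep

/-! ### Rings with convolution representations, and their spectra -/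

/-- Rings, as the objects whose morphisms are isomorphism classes of convolution
representations. -/
structure ConvRing : Type (u + 1) where
  carrier : Type u
  [ring : Ring carrier]

attribute [instance] ConvRing.ring

/-- A morphism `B ⟶ A` is an isomorphism class of convolution representations of `B` over `A`. -/
instance : CategoryStruct ConvRing.{u} where
  Hom B A := Quotient (ConvRep.setoid B.carrier A.carrier)
  id A := Quotient.mk _ (ConvRep.id A.carrier)
  comp := Quotient.map₂ ConvRep.comp fun _ _ hs _ _ hr => ConvRep.comp_congr hs hr

/-- The morphism given by a convolution representation. -/
def ConvRep.toHom {B A : ConvRing.{u}} (r : ConvRep B.carrier A.carrier) : B ⟶ A :=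
  Quotient.mk (ConvRep.setoid B.carrier A.carrier) r

/-- The spectrum of `A`: the noncommutative scheme `(Bimod(A), ⊗_A, A)`. -/
@[reducible] noncomputable def Spec (A : ConvRing.{u}) : NCScheme.{u, u + 1} := ⟨Bimodule A.carrier⟩

/-- The direct image `Hom_A(D, -)_A` of the morphism given by a convolution representation. -/
noncomputable def ConvRep.toDirectImage {B A : ConvRing.{u}} (r : ConvRep B.carrier A.carrier) :
    NCScheme.DirectImage (Spec A) (Spec B) :=
  ⟨r.directImage⟩

/-- The morphism of spectra given by an isomorphism class of convolution representations. -/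
noncomputable def specMap {B A : ConvRing.{u}} : (B ⟶ A) → (Spec A ⟶ Spec B) :=
  Quotient.map ConvRep.toDirectImage fun _ _ ⟨e, h⟩ =>
    ⟨ConvRep.directImageIso e h, ConvRep.directImageIso_isMonoidal e h⟩

lemma specMap_toHom {B A : ConvRing.{u}} (r : ConvRep B.carrier A.carrier) :
    specMap r.toHom = r.toDirectImage.toHom := rfl

/-- The representation of `B` over `A` that an inverse image functor `f^*` of a morphism
`Spec(A) ⟶ Spec(B)` gives: the coalgebra `f^*(B ⊗ B)` with its homomorphism from `B`. -/
noncomputable def ConvRep.ofScheme {A B : ConvRing.{u}}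
    {f : NCScheme.DirectImage (Spec A) (Spec B)} (L : NCScheme.InverseImage f) :
    ConvRep B.carrier A.carrier :=
  @ConvRep.ofInverseImage B.carrier A.carrier _ _ L.functor L.additive L.oplax

/-- The axioms of a category. -/
structure IsCategory (C : Type u) [CategoryStruct.{v} C] : Prop where
  id_comp : ∀ {X Y : C} (f : X ⟶ Y), 𝟙 X ≫ f = f
  comp_id : ∀ {X Y : C} (f : X ⟶ Y), f ≫ 𝟙 Y = f
  assoc : ∀ {W X Y Z : C} (f : W ⟶ X) (g : X ⟶ Y) (h : Y ⟶ Z), (f ≫ g) ≫ h = f ≫ g ≫ h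

/-- The category given by the axioms. -/
@[reducible] def IsCategory.toCategory {C : Type u} [CategoryStruct.{v} C] (h : IsCategory C) :
    Category.{v} C where
  id_comp := h.id_comp
  comp_id := h.comp_id
  assoc := h.assoc

/-- The contravariant functor `A ↦ Spec(A)`, once the category axioms and functoriality hold. -/
noncomputable def specFunctor (h : IsCategory ConvRing.{u})
    (h_id : ∀ A : ConvRing.{u}, specMap (𝟙 A) = 𝟙 (Spec A))
    (h_comp : ∀ (C B A : ConvRing.{u}) (g : C ⟶ B) (f : B ⟶ A),
      specMap (g ≫ f) = specMap f ≫ specMap g) :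
    letI := h.toCategory
    ConvRing.{u}ᵒᵖ ⥤ NCScheme.{u, u + 1} :=
  letI := h.toCategory
  { obj := fun A => Spec A.unop
    map := fun f => specMap f.unop
    map_id := fun A => h_id A.unop
    map_comp := fun g f => h_comp _ _ _ f.unop g.unop }

end NCS

namespace NCS

/-! ### Comonoidal functors and the actions of functionals -/

section Oplax

variable {C : Type u} [Category.{v} C] [MonoidalCategory C] {C' : Type u} [Category.{v} C']
  [MonoidalCategory C'] (L : C ⥤ C') [L.OplaxMonoidal] (D : Comon C)

open Functor.OplaxMonoidal

/-! A convolution representation of `B` over `A` is the same thing as a representable lax monoidal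
functor `Bimod(A) ⥤ Bimod(B)`. The coalgebra structure of `D` and the map from `B` can be read off
from the monoidal structure of `Hom(D, -)`, and composition of representations corresponds to
composition of functors. Three facts make this precise.

Transport. Let `L ⊣ G` be an additive adjunction whose comonoidal and monoidal structures
correspond. The bijection `Hom(L(E), M) ≅ Hom(E, G(M))` is then a monoidal isomorphism from the
direct image of `s.transport L` to `G ⋙ s.directImage` (`transportDirectImageIso_isMonoidal`). It is
linear over the represented ring because `L` carries the actions of functionals on `E` to those on
`L(E)` (`actR_mapComon`, `actL_mapComon`). Since `s.comp r` is the transport of `s` along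
`r.inverseImage`, `specMap` reverses composition.

Identity. The bimodule `A ⊗ A` is free on the group-like element `1 ⊗ 1`, so evaluation there
identifies `Hom(A ⊗ A, -)` with the identity functor, monoidally (`idDirectImageIso_isMonoidal`).
Transporting the identity representation of `B` along `L` therefore gives a representation on `L(B ⊗
B)` with direct image `G` (`ofInverseImage_directImage`). This is part (3). It also gives fullness,
because the left adjoint of a lax monoidal functor always carries the corresponding comonoidal
structure.

Yoneda. A natural isomorphism `Hom(D, -) ≅ Hom(D', -)` comes from an isomorphism `D' ≅ D`.
Compatibility with the tensor structure says that it respects comultiplication, and compatibility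
with the unit says that it respects the maps from `B`, hence the counits
(`setoid_of_directImageIso`). This is faithfulness.

The category laws need no construction of associativity or unit isomorphisms between corings:
`specMap` is injective, preserves identities and reverses composition, so they follow from the laws
for noncommutative schemes. -/

lemma actR_mapComon (f : D.X ⟶ 𝟙_ C) :
    actR (D := (L.mapComon.obj D).X) (L.map f ≫ η L) = L.map (actR f) := by
  have h : (L.map f ≫ η L) ▷ L.obj D.X = L.map f ▷ L.obj D.X ≫ η L ▷ L.obj D.X :=
    comp_whiskerRight _ _ _
  change (L.map ComonObj.comul ≫ δ L D.X D.X) ≫ (L.map f ≫ η L) ▷ L.obj D.X ≫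
    (λ_ (L.obj D.X)).hom = L.map (ComonObj.comul ≫ f ▷ D.X ≫ (λ_ D.X).hom)
  -- Left unitality writes the image of the unitor through `δ` and `η`; naturality of `δ` then moves
  -- `f` across.
  rw [h, L.map_comp, L.map_comp, left_unitality_hom L D.X |>.symm, Category.assoc, Category.assoc,
    δ_natural_left_assoc]

lemma actL_mapComon (f : D.X ⟶ 𝟙_ C) :
    actL (D := (L.mapComon.obj D).X) (L.map f ≫ η L) = L.map (actL f) := by
  have h : L.obj D.X ◁ (L.map f ≫ η L) = L.obj D.X ◁ L.map f ≫ L.obj D.X ◁ η L :=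
    MonoidalCategory.whiskerLeft_comp _ _ _
  change (L.map ComonObj.comul ≫ δ L D.X D.X) ≫ L.obj D.X ◁ (L.map f ≫ η L) ≫
    (ρ_ (L.obj D.X)).hom = L.map (ComonObj.comul ≫ D.X ◁ f ≫ (ρ_ D.X).hom)
  rw [h, L.map_comp, L.map_comp, right_unitality_hom L D.X |>.symm, Category.assoc,
    Category.assoc, δ_natural_right_assoc]

end Oplax

namespace ConvRep

variable {F B A : Type u} [Ring F] [Ring B] [Ring A]

/-! ### Direct images of transported representations -/

section Transport

variable (s : ConvRep F B) {L : Bimodule B ⥤ Bimodule A} {G : Bimodule A ⥤ Bimodule B}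
  [L.Additive] [L.OplaxMonoidal] [G.Additive] [G.LaxMonoidal] (adj : L ⊣ G)

open Functor.OplaxMonoidal Functor.LaxMonoidal

/-- The functional of `x` on `L(E)` is by definition `L.map (s.ev x) ≫ η L`. This identity is what
makes transposition along the adjunction linear over `F`. -/
lemma actR_transport_ev (x : F) :
    actR ((s.transport L).ev x) = L.map (actR (s.ev x)) := actR_mapComon L s.D _

lemma actL_transport_ev (x : F) :
    actL ((s.transport L).ev x) = L.map (actL (s.ev x)) := actL_mapComon L s.D _

/-- The adjunction isomorphism `Hom(L(E), M) ≅ Hom(E, G(M))`. -/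
def transportEquiv (M : Bimodule A) :
    (s.transport L).homBimodule M ⟶ s.homBimodule (G.obj M) where
  hom := AddMonoidHom.mk'
    (fun n => s.toEl (adj.homEquiv s.D.X M ((s.transport L).toEl.symm n)))
    (fun n n' => by
      rw [map_add]
      -- Transposition is `n ↦ unit ≫ G(n)`, which is additive because `G` is.
      exact congrArg s.toEl ((adj.homEquiv_unit _ _ _).trans
        (((congrArg (adj.unit.app s.D.X ≫ ·) G.map_add).trans
        (Preadditive.comp_add _ _ _ _ _ _)).trans (congrArg₂ (· + ·)
          (adj.homEquiv_unit _ _ _).symm (adj.homEquiv_unit _ _ _).symm))))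
  map_left x n := by
    change adj.homEquiv s.D.X M (actR (D := (s.transport L).D.X) ((s.transport L).ev x) ≫ (s.transport L).toEl.symm n) =
      actR (s.ev x) ≫ adj.homEquiv s.D.X M ((s.transport L).toEl.symm n)
    -- The action now precomposes with a morphism in the image of `L`, so naturality of
    -- transposition in its first variable takes it out.
    rw [actR_transport_ev]
    exact adj.homEquiv_naturality_left _ _
  map_right x n := by
    change adj.homEquiv s.D.X M (actL (D := (s.transport L).D.X) ((s.transport L).ev x.unop) ≫ (s.transport L).toEl.symm n) =
      actL (s.ev x.unop) ≫ adj.homEquiv s.D.X M ((s.transport L).toEl.symm n)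
    rw [actL_transport_ev]
    exact adj.homEquiv_naturality_left _ _

/-- The inverse of `transportEquiv`. -/
def transportEquivInv (M : Bimodule A) :
    s.homBimodule (G.obj M) ⟶ (s.transport L).homBimodule M where
  hom := AddMonoidHom.mk'
    (fun n => (s.transport L).toEl ((adj.homEquiv s.D.X M).symm (s.toEl.symm n)))
    (fun n n' => by
      rw [map_add]
      -- The inverse transposition is `n ↦ L(n) ≫ counit`, so here additivity of `L` is needed.
      exact congrArg (s.transport L).toEl ((adj.homEquiv_counit _ _ _).trans
        (((congrArg (· ≫ adj.counit.app M) L.map_add).trans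
        (Preadditive.add_comp _ _ _ _ _ _)).trans (congrArg₂ (· + ·)
          (adj.homEquiv_counit _ _ _).symm (adj.homEquiv_counit _ _ _).symm))))
  map_left x n := by
    change (adj.homEquiv s.D.X M).symm (actR (s.ev x) ≫ s.toEl.symm n) =
      actR (D := (s.transport L).D.X) ((s.transport L).ev x) ≫
        (adj.homEquiv s.D.X M).symm (s.toEl.symm n)
    rw [actR_transport_ev]
    exact adj.homEquiv_naturality_left_symm _ _
  map_right x n := by
    change (adj.homEquiv s.D.X M).symm (actL (s.ev x.unop) ≫ s.toEl.symm n) =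
      actL (D := (s.transport L).D.X) ((s.transport L).ev x.unop) ≫
        (adj.homEquiv s.D.X M).symm (s.toEl.symm n)
    rw [actL_transport_ev]
    exact adj.homEquiv_naturality_left_symm _ _

/-- The direct image of a transported representation is the composite of the direct image with the
right adjoint of the comonoidal functor. -/
def transportDirectImageIso : (s.transport L).directImage ≅ G ⋙ s.directImage :=
  NatIso.ofComponents (fun M =>
    { hom := transportEquiv s adj M
      inv := transportEquivInv s adj M
      hom_inv_id := Bimodule.hom_ext fun _ => (adj.homEquiv s.D.X M).symm_apply_apply _
      inv_hom_id := Bimodule.hom_ext fun _ => (adj.homEquiv s.D.X M).apply_symm_apply _ })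
    (fun f => Bimodule.hom_ext fun n =>
      adj.homEquiv_naturality_right ((s.transport L).toEl.symm n) f)

/-- This is where the correspondence between the structures of `L` and `G` enters: its unit half
matches `η L` with `ε G`, its tensor half `δ L` with `μ G`. -/
lemma transportDirectImageIso_isMonoidal [adj.IsMonoidal] :
    NatTrans.IsMonoidal (transportDirectImageIso s adj).hom where
  unit := Bimodule.hom_ext fun (x : F) => by
    change adj.homEquiv s.D.X _ (L.map (s.ev x) ≫ η L) = s.ev x ≫ ε G
    rw [adj.homEquiv_naturality_left, adj.homEquiv_unit, adj.unit_app_unit_comp_map_η]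
  tensor M N := Bimodule.tensor_ext fun (m : (s.transport L).homBimodule M)
      (n : (s.transport L).homBimodule N) => by
    let m' : L.obj s.D.X ⟶ M := (s.transport L).toEl.symm m
    let n' : L.obj s.D.X ⟶ N := (s.transport L).toEl.symm n
    change adj.homEquiv s.D.X (M ⊗ N) ((L.map ComonObj.comul ≫ δ L s.D.X s.D.X) ≫ (m' ⊗ₘ n')) =
      (ComonObj.comul ≫ (adj.homEquiv s.D.X M m' ⊗ₘ adj.homEquiv s.D.X N n')) ≫ μ G M N
    -- After the comultiplication of `E` is taken out, the transpose of `δ L` becomes `(unit ⊗ unit)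
    -- ≫ μ G`. Naturality of `μ G` then moves `G(m') ⊗ G(n')` before it, which leaves the tensor
    -- product of the two transposes.
    rw [Category.assoc, adj.homEquiv_naturality_left, adj.homEquiv_naturality_right,
      adj.homEquiv_unit, adj.unit_app_tensor_comp_map_δ, adj.homEquiv_unit, adj.homEquiv_unit,
      Category.assoc, Category.assoc, ← Functor.LaxMonoidal.μ_natural,
      MonoidalCategory.tensorHom_comp_tensorHom_assoc]

end Transport

/-! ### The identity representation -/

section Identity

/-- The generator `1 ⊗ 1` is group-like. As it determines every bimodule map out of `A ⊗ A`,
computations with the identity representation reduce to this element. -/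
lemma comul_freeTmul_one : (ComonObj.comul (X := freeBimodule A)).hom (freeTmul 1 1) =
    Bimodule.tmul (freeTmul 1 1) (freeTmul 1 1) :=
  freeLift_one _

/-- Applying the functional of `a` to one leg of the group-like generator gives `a` times the other
leg. The action in general is `x ⊗ y ↦ xa ⊗ y`, which agrees with left multiplication by `a` at the
generator but not everywhere. This agreement makes evaluation at `1 ⊗ 1` left linear. -/
lemma actR_id_ev_one (a : A) :
    (actR (D := freeBimodule A) ((ConvRep.id A).ev a)).hom (freeTmul 1 1) =
      a • freeTmul (1 : A) 1 := by
  change (((ConvRep.id A).ev a ▷ freeBimodule A) ≫ (λ_ (freeBimodule A)).hom).hom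
    ((ComonObj.comul (X := freeBimodule A)).hom (freeTmul 1 1)) = _
  rw [comul_freeTmul_one]
  exact congrArg (fun b : A => b • freeTmul (1 : A) 1)
    (freeLift_one (M := Bimodule.regular A) a)

lemma actL_id_ev_one (a : A) :
    (actL (D := freeBimodule A) ((ConvRep.id A).ev a)).hom (freeTmul 1 1) =
      MulOpposite.op a • freeTmul (1 : A) 1 := by
  change ((freeBimodule A ◁ (ConvRep.id A).ev a) ≫ (ρ_ (freeBimodule A)).hom).hom
    ((ComonObj.comul (X := freeBimodule A)).hom (freeTmul 1 1)) = _
  rw [comul_freeTmul_one]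
  exact congrArg (fun b : A => MulOpposite.op b • freeTmul (1 : A) 1)
    (freeLift_one (M := Bimodule.regular A) a)

/-- Evaluation at `1 ⊗ 1`. -/
def evalOne (M : Bimodule A) : (ConvRep.id A).homBimodule M ⟶ M where
  hom := AddMonoidHom.mk' (fun n => ((ConvRep.id A).toEl.symm n).hom (freeTmul 1 1))
    (fun _ _ => rfl)
  map_left a n := (congrArg ((ConvRep.id A).toEl.symm n).hom (actR_id_ev_one a)).trans
    (((ConvRep.id A).toEl.symm n).map_left a (freeTmul (1 : A) 1))
  map_right a n := (congrArg ((ConvRep.id A).toEl.symm n).hom (actL_id_ev_one a.unop)).trans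
    (((ConvRep.id A).toEl.symm n).map_right a (freeTmul (1 : A) 1))

/-- Since `1 ⊗ 1` generates `A ⊗ A`, the additivity and linearity of the inverse can be checked
after evaluation. -/
lemma evalOne_injective (M : Bimodule A) : Function.Injective (evalOne M).hom :=
  fun _ _ h => free_ext h

lemma evalOne_freeLift {M : Bimodule A} (m : M) :
    (evalOne M).hom ((ConvRep.id A).toEl (freeLift m)) = m := freeLift_one m

/-- The inverse of `evalOne`. -/
def evalOneInv (M : Bimodule A) : M ⟶ (ConvRep.id A).homBimodule M where
  hom := AddMonoidHom.mk' (fun m => (ConvRep.id A).toEl (freeLift m)) (fun m m' =>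
    evalOne_injective M (by rw [map_add, evalOne_freeLift, evalOne_freeLift, evalOne_freeLift]))
  map_left a m := evalOne_injective M (by
    rw [Bimodule.Hom.map_left]
    exact (evalOne_freeLift _).trans (congrArg (a • ·) (evalOne_freeLift m).symm))
  map_right a m := evalOne_injective M (by
    rw [Bimodule.Hom.map_right]
    exact (evalOne_freeLift _).trans (congrArg (a • ·) (evalOne_freeLift m).symm))

/-- The direct image of the identity representation is the identity functor. -/
def idDirectImageIso (A : Type u) [Ring A] : (ConvRep.id A).directImage ≅ 𝟭 (Bimodule A) :=
  NatIso.ofComponents (fun M => Bimodule.mkIso (evalOne M) (evalOneInv M)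
      (fun _ => evalOne_injective M (evalOne_freeLift _)) evalOne_freeLift)
    (fun _ => Bimodule.hom_ext fun _ => rfl)

/-- The functional of `a` takes the value `a` at `1 ⊗ 1`, which is the unit condition. The tensor
condition is group-likeness: the product of `m` and `n` takes the value `m(1 ⊗ 1) ⊗ n(1 ⊗ 1)` there.
-/
lemma idDirectImageIso_isMonoidal (A : Type u) [Ring A] :
    NatTrans.IsMonoidal (idDirectImageIso A).hom where
  unit := Bimodule.hom_ext fun (a : A) => freeLift_one (M := Bimodule.regular A) a
  tensor M N := Bimodule.tensor_ext fun (m : (ConvRep.id A).homBimodule M)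
      (n : (ConvRep.id A).homBimodule N) =>
    congrArg (((ConvRep.id A).toEl.symm m ⊗ₘ (ConvRep.id A).toEl.symm n).hom)
      (comul_freeTmul_one (A := A))

end Identity

/-- The representation given by a comonoidal functor represents its right adjoint. -/
lemma ofInverseImage_directImage {L : Bimodule B ⥤ Bimodule A} {G : Bimodule A ⥤ Bimodule B}
    [L.Additive] [L.OplaxMonoidal] [G.Additive] [G.LaxMonoidal] (adj : L ⊣ G) [adj.IsMonoidal] :
    ∃ e : (ofInverseImage L).directImage ≅ G, NatTrans.IsMonoidal e.hom := by
  have := transportDirectImageIso_isMonoidal (ConvRep.id B) adj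
  have := idDirectImageIso_isMonoidal B
  exact ⟨transportDirectImageIso (ConvRep.id B) adj ≪≫
      Functor.isoWhiskerLeft G (idDirectImageIso B) ≪≫ G.rightUnitor,
    inferInstanceAs (NatTrans.IsMonoidal ((transportDirectImageIso (ConvRep.id B) adj).hom ≫
      Functor.whiskerLeft G (idDirectImageIso B).hom ≫ G.rightUnitor.hom))⟩

/-! ### A representation is determined by its direct image -/

section Yoneda

variable {r s : ConvRep B A} (e : r.directImage ≅ s.directImage)

/-- The bimodule map `D' ⟶ D` that represents a natural transformation `Hom(D, -) ⟶ Hom(D', -)`. -/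
def repr (t : r.directImage ⟶ s.directImage) : s.D.X ⟶ r.D.X :=
  s.toEl.symm ((t.app r.D.X).hom (r.toEl (𝟙 r.D.X)))

/-- The Yoneda argument: `n` is the image of the identity of `D` under postcomposition with `n`, so
naturality determines `t` from its value at that identity. -/
lemma app_toEl (t : r.directImage ⟶ s.directImage) {M : Bimodule A} (n : r.D.X ⟶ M) :
    (t.app M).hom (r.toEl n) = s.toEl (repr t ≫ n) := by
  have h := congrArg (fun k => k.hom (r.toEl (𝟙 r.D.X))) (t.naturality n)
  have h' : (t.app M).hom (r.toEl (𝟙 r.D.X ≫ n)) = s.toEl (repr t ≫ n) := h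
  rwa [Category.id_comp] at h'

/-- Both sides are the value of `e.inv ≫ e.hom` at the identity of the coalgebra of `s`. The other
composite is the same statement for `e.symm`. -/
lemma repr_comp_repr : repr e.hom ≫ repr e.inv = 𝟙 s.D.X := by
  have h := congrArg (fun k => Bimodule.Hom.hom k (s.toEl (𝟙 s.D.X)))
    (e.inv_hom_id_app s.D.X)
  have h' : (e.hom.app s.D.X).hom (r.toEl (repr e.inv)) = s.toEl (𝟙 s.D.X) := h
  rw [app_toEl] at h'
  exact s.toEl.injective h'

/-- The unit of each direct image sends `b` to its functional, so the unit condition evaluated at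
`b` says that `t` takes `r.ev b` to `s.ev b`. -/
lemma repr_ev (t : r.directImage ⟶ s.directImage) [NatTrans.IsMonoidal t] (b : B) :
    repr t ≫ r.ev b = s.ev b := by
  have h := congrArg (fun k => Bimodule.Hom.hom k b) (NatTrans.IsMonoidal.unit (τ := t))
  exact s.toEl.injective ((app_toEl t (r.ev b)).symm.trans h)

/-- The comultiplication of `D` is the product of the identity of `D` with itself under the monoidal
structure of `Hom(D, -)`. The tensor condition at this pair of identities is therefore the claim. -/
lemma repr_comul (t : r.directImage ⟶ s.directImage) [NatTrans.IsMonoidal t] :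
    repr t ≫ ComonObj.comul = ComonObj.comul ≫ (repr t ⊗ₘ repr t) := by
  have h := congrArg (fun k => Bimodule.Hom.hom k
      (Bimodule.tmul (M := r.homBimodule r.D.X) (N := r.homBimodule r.D.X)
        (r.toEl (𝟙 r.D.X)) (r.toEl (𝟙 r.D.X))))
    (NatTrans.IsMonoidal.tensor (τ := t) r.D.X r.D.X)
  have h' : (t.app (r.D.X ⊗ r.D.X)).hom (r.toEl (ComonObj.comul ≫ (𝟙 r.D.X ⊗ₘ 𝟙 r.D.X))) =
    s.toEl (ComonObj.comul ≫ (repr t ⊗ₘ repr t)) := h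
  rw [id_tensorHom_id, Category.comp_id, app_toEl] at h'
  exact s.toEl.injective h'

/-- Representations with monoidally isomorphic direct images are isomorphic. -/
lemma setoid_of_directImageIso (he : NatTrans.IsMonoidal e.hom) : ConvRep.setoid B A r s := by
  -- The counit is the functional of `1`, so this is a case of compatibility with the maps from `B`.
  have hc : repr e.hom ≫ ComonObj.counit = ComonObj.counit := by
    rw [← r.ev_one, ← s.ev_one, repr_ev]
  -- By contravariance `repr e.hom` goes from the coalgebra of `s` to that of `r`, hence the
  -- reversal.
  exact (ConvRep.setoid B A).symm
    ⟨Comon.mkIso ⟨repr e.hom, repr e.inv, repr_comp_repr e, repr_comp_repr e.symm⟩ hc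
      (repr_comul e.hom), fun b => (repr_ev e.hom b).symm⟩

end Yoneda

end ConvRep

/-! ### The spectrum functor -/

/-- Morphisms on both sides are isomorphism classes, so this is the Yoneda argument applied to
representatives. The category laws rest on it as well as faithfulness. -/
lemma specMap_injective {B A : ConvRing.{u}} :
    Function.Injective (specMap : (B ⟶ A) → (Spec A ⟶ Spec B)) := by
  rintro ⟨r⟩ ⟨s⟩ h
  obtain ⟨e, he⟩ := Quotient.exact h
  exact Quotient.sound (ConvRep.setoid_of_directImageIso e he)

lemma specMap_id (A : ConvRing.{u}) : specMap (𝟙 A) = 𝟙 (Spec A) :=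
  Quotient.sound ⟨ConvRep.idDirectImageIso A.carrier, ConvRep.idDirectImageIso_isMonoidal _⟩

/-- The comonoidal structure of the inverse image was defined as the mate of the monoidal structure
of the direct image, so the two correspond by construction. -/
instance {B A : Type u} [Ring B] [Ring A] (r : ConvRep B A) : r.adj.IsMonoidal :=
  inferInstanceAs (letI := r.adj.leftAdjointOplaxMonoidal; r.adj.IsMonoidal)

/-- Composition of representations is transport along `r.inverseImage`, whose right adjoint is
`r.directImage`. -/
lemma specMap_comp {C B A : ConvRing.{u}} (g : C ⟶ B) (f : B ⟶ A) :
    specMap (g ≫ f) = specMap f ≫ specMap g := by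
  obtain ⟨s⟩ := g
  obtain ⟨r⟩ := f
  exact Quotient.sound ⟨ConvRep.transportDirectImageIso s (G := r.directImage) r.adj,
    ConvRep.transportDirectImageIso_isMonoidal s (G := r.directImage) r.adj⟩

lemma specMap_ofScheme {A B : ConvRing.{u}} (f : NCScheme.DirectImage (Spec A) (Spec B))
    (L : NCScheme.InverseImage f) : specMap (ConvRep.ofScheme L).toHom = f.toHom := by
  exact Quotient.sound (@ConvRep.ofInverseImage_directImage B.carrier A.carrier _ _ L.functor
    f.functor L.additive L.oplax f.additive f.lax L.adj L.isMonoidal)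

/-- Every direct image functor has an inverse image. -/
noncomputable def NCScheme.InverseImage.ofDirectImage {X Y : NCScheme.{v, u}}
    (f : NCScheme.DirectImage X Y) : NCScheme.InverseImage f :=
  letI adj := Adjunction.ofIsRightAdjoint f.functor
  -- The mates of `ε` and `μ` make any left adjoint of a lax monoidal functor comonoidal, with the
  -- required correspondence.
  letI := adj.leftAdjointOplaxMonoidal
  haveI := adj.left_adjoint_additive
  ⟨f.functor.leftAdjoint, adj⟩

lemma specMap_surjective {B A : ConvRing.{u}} :
    Function.Surjective (specMap : (B ⟶ A) → (Spec A ⟶ Spec B)) := by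
  rintro ⟨f⟩
  exact ⟨_, specMap_ofScheme f (NCScheme.InverseImage.ofDirectImage f)⟩

/-- The laws are pulled back along the injective `specMap`. As it reverses composition, each unit
law comes from the opposite one for schemes. -/
lemma isCategory_convRing : IsCategory ConvRing.{u} where
  id_comp f := specMap_injective (by rw [specMap_comp, specMap_id, Category.comp_id])
  comp_id f := specMap_injective (by rw [specMap_comp, specMap_id, Category.id_comp])
  assoc f g h := specMap_injective (by simp only [specMap_comp, Category.assoc])

end NCS

/-- The laws and functoriality are bound first because fullness and faithfulness refer to the
category and functor built from them. The last clause ranges over every inverse image `L` of `f`,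
not only a chosen one. -/
theorem theorem1 :
    ∃ (laws : NCS.IsCategory NCS.ConvRing.{u})
      (map_id : ∀ A : NCS.ConvRing.{u}, NCS.specMap (𝟙 A) = 𝟙 (NCS.Spec A))
      (map_comp : ∀ (C B A : NCS.ConvRing.{u}) (g : C ⟶ B) (f : B ⟶ A),
        NCS.specMap (g ≫ f) = NCS.specMap f ≫ NCS.specMap g),
      letI := laws.toCategory
      (NCS.specFunctor laws map_id map_comp).Full ∧
      (NCS.specFunctor laws map_id map_comp).Faithful ∧
      ∀ (A B : NCS.ConvRing.{u}) (f : NCS.NCScheme.DirectImage (NCS.Spec A) (NCS.Spec B))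
        (L : NCS.NCScheme.InverseImage f),
        NCS.specMap (NCS.ConvRep.ofScheme L).toHom = f.toHom := by
  refine ⟨NCS.isCategory_convRing, NCS.specMap_id, fun _ _ _ => NCS.specMap_comp, ?_, ?_,
    fun _ _ => NCS.specMap_ofScheme⟩
  · let := NCS.isCategory_convRing.{u}.toCategory
    exact { map_surjective := fun k =>
      let ⟨f, hf⟩ := NCS.specMap_surjective k
      ⟨f.op, hf⟩ }
  · let := NCS.isCategory_convRing.{u}.toCategory
    exact { map_injective := fun h => Quiver.Hom.unop_inj (NCS.specMap_injective h) }
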